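/- For an oriented link $L$ let $\#L$ be its number of components and let $P_L(v,z)\in\mathbb Z[v^{\pm1},z^{\pm1}]$ be its HOMFLY polynomial, i.e. the invariant of oriented links determined by $P_{U}=1$ for the unknot $U$ and the skein relation $$v^{-1}P_{L_+}(v,z)-v\,P_{L_-}(v,z)=z\,P_{L_0}(v,z),$$ where $L_+,L_-,L_0$ agree outside a small ball, in which they have a positive crossing, a negative crossing and the oriented smoothing, respectively. Write $$P_L(v,z)=(v^{-1}z)^{1-\#L}\sum_{i\ge 0}p^i_L(v)\,z^{2i};$$ the Laurent polynomial $p^0_L(v)$ is the zeroth coefficient polynomial of $L$. Let $\sigma_i$ $(1\le i\le 2n-1)$ be the standard generators (positive crossings) of the braid group on $2n$ strands, and let $[\varepsilon_1i_1,\dots,\varepsilon_mi_m]$, with $\varepsilon_j=\pm1$, denote the braid $\sigma_{i_1}^{\varepsilon_1}\cdots\sigma_{i_m}^{\varepsilon_m}$. For $n\ge 2$ let $X_n$ be the $2n$-braid $$X_n=[\,n,\ n-1,n+1,\ n-2,n,n+2,\ \dots,\ 1,3,\dots,2n-1,\ 2n-2,\dots,4,2,\ \dots,\ n+1,n-1,\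 n\,],$$ that is, the rows $(n-k,n-k+2,\dots,n+k)$ for $k=0,1,\dots,n-1$, followed by the rows $(n+k,n+k-2,\dots,n-k)$ for $k=n-2,\dots,1,0$. Let $K_n$ be the closure of the $2n$-braid $$\beta_n=X_n^3\cdot[\,-1,-2,\dots,-(n-1),\ n,n-1,\dots,2,1,\ 1,2,\dots,n\,].$$ Then, for every $n\ge 2$, the top term of $p^0_{K_n}(v)$ is $(-1)^n v^{3n^2+3n}$: the polynomial $p^0_{K_n}(v)$ has degree $3n^2+3n$ in $v$, and the coefficient of $v^{3n^2+3n}$ in it is $(-1)^n$. -/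

import Mathlib

open scoped LaurentPolynomial

namespace BraidLink

/-- The Artin relations for generators `σ_0, …, σ_{m-1}`: far commutativity and the braid
relation. -/
def artinRels (m : ℕ) : Set (FreeGroup (Fin m)) :=
  {r | ∃ i j : Fin m, (i : ℕ) + 1 < j ∧
      r = FreeGroup.of i * FreeGroup.of j * (FreeGroup.of j * FreeGroup.of i)⁻¹} ∪
  {r | ∃ i j : Fin m, (i : ℕ) + 1 = j ∧
      r = FreeGroup.of i * FreeGroup.of j * FreeGroup.of i *
        (FreeGroup.of j * FreeGroup.of i * FreeGroup.of j)⁻¹}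

/-- The braid group on `m + 1` strands (that is, with `m` standard generators), in Artin's
presentation. -/
abbrev Braid (m : ℕ) : Type := PresentedGroup (artinRels m)

/-- The standard generator (a positive crossing of the strands in positions `i` and `i + 1`,
positions being counted from `0`). -/
def sigma {m : ℕ} (i : Fin m) : Braid m := PresentedGroup.of i

/-- A homomorphism out of the braid group, from elements satisfying the Artin relations. -/
def lift {m : ℕ} {G : Type*} [Group G] (f : Fin m → G)
    (h1 : ∀ i j : Fin m, (i : ℕ) + 1 < j → f i * f j = f j * f i)
    (h2 : ∀ i j : Fin m, (i : ℕ) + 1 = j → f i * f j * f i = f j * f i * f j) :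
    Braid m →* G :=
  PresentedGroup.toGroup (f := f) (by
    rintro r (⟨i, j, hij, rfl⟩ | ⟨i, j, hij, rfl⟩)
    · simp [h1 i j hij]
    · simp [h2 i j hij])

@[simp] theorem lift_sigma {m : ℕ} {G : Type*} [Group G] (f : Fin m → G) (h1) (h2) (i : Fin m) :
    lift f h1 h2 (sigma i) = f i := by
  simp [lift, sigma]

theorem sigma_comm {m : ℕ} (i j : Fin m) (h : (i : ℕ) + 1 < j) :
    sigma i * sigma j = sigma j * sigma i := by
  have := PresentedGroup.one_of_mem (rels := artinRels m) (Or.inl ⟨i, j, h, rfl⟩)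
  rw [map_mul, map_inv, mul_inv_eq_one, map_mul, map_mul] at this
  exact this

theorem sigma_braid {m : ℕ} (i j : Fin m) (h : (i : ℕ) + 1 = j) :
    sigma i * sigma j * sigma i = sigma j * sigma i * sigma j := by
  have := PresentedGroup.one_of_mem (rels := artinRels m) (Or.inr ⟨i, j, h, rfl⟩)
  rw [map_mul, map_inv, mul_inv_eq_one] at this
  rwa [map_mul, map_mul, map_mul, map_mul] at this

/-- The inclusion of braid groups that adds one strand on the last position. -/
def addStrand (m : ℕ) : Braid m →* Braid (m + 1) :=
  lift (fun i => sigma i.castSucc)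
    (fun i j h => sigma_comm _ _ (by simpa using h))
    (fun i j h => sigma_braid _ _ (by simpa using h))

@[simp] theorem addStrand_sigma {m : ℕ} (i : Fin m) :
    addStrand m (sigma i) = sigma i.castSucc := by
  simp [addStrand]

/-- The permutation of the strand positions induced by a braid. -/
def perm (m : ℕ) : Braid m →* Equiv.Perm (Fin (m + 1)) :=
  lift (fun i => Equiv.swap i.castSucc i.succ)
    (fun i j h => by
      refine (Equiv.Perm.Disjoint.commute (Equiv.Perm.disjoint_swap_swap ?_)).eq
      simp only [List.nodup_cons, List.mem_cons, List.not_mem_nil, Fin.ext_iff, Fin.val_castSucc,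
        Fin.val_succ, List.nodup_nil, not_or, or_false, not_false_eq_true, and_true]
      omega)
    (fun i j h => by
      have e : j.castSucc = i.succ := by simp [Fin.ext_iff, ← h]
      have e1 : i.castSucc ≠ i.succ := by simp [Fin.ext_iff]
      have e2 : i.castSucc ≠ j.succ := by simp [Fin.ext_iff]; omega
      have e3 : i.succ ≠ j.succ := by simp [Fin.ext_iff]; omega
      have h3 := Equiv.swap_mul_swap_mul_swap e3.symm e2.symm
      rw [e, Equiv.swap_mul_swap_mul_swap e1 e2, Equiv.swap_comm j.succ, ← h3,
        Equiv.swap_comm i.succ i.castSucc, Equiv.swap_comm j.succ i.succ])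

@[simp] theorem perm_sigma {m : ℕ} (i : Fin m) :
    perm m (sigma i) = Equiv.swap i.castSucc i.succ := by
  simp [perm]

/-- The Markov moves on braids with any number of strands: conjugation, and positive and
negative stabilization. -/
inductive MarkovMove : (Σ m, Braid m) → (Σ m, Braid m) → Prop
  | conj (m : ℕ) (α β : Braid m) : MarkovMove ⟨m, β⟩ ⟨m, α * β * α⁻¹⟩
  | stab_pos (m : ℕ) (β : Braid m) :
      MarkovMove ⟨m, β⟩ ⟨m + 1, addStrand m β * sigma (Fin.last m)⟩
  | stab_neg (m : ℕ) (β : Braid m) :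
      MarkovMove ⟨m, β⟩ ⟨m + 1, addStrand m β * (sigma (Fin.last m))⁻¹⟩

/-- Oriented link types in the three-sphere (non-empty links), presented as closed braids: by the
theorems of Alexander and Markov, every oriented link is the closure of a braid, and two braids
have isotopic closures exactly when they are related by Markov moves. -/
def OrientedLink : Type := Quot MarkovMove

/-- The closure of a braid. -/
def closure {m : ℕ} (β : Braid m) : OrientedLink := Quot.mk _ ⟨m, β⟩

theorem closure_conj {m : ℕ} (α β : Braid m) : closure (α * β * α⁻¹) = closure β :=
  (Quot.sound (MarkovMove.conj m α β)).symm

theorem closure_mul_comm {m : ℕ} (α β : Braid m) : closure (α * β) = closure (β * α) := by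
  rw [← closure_conj β (α * β)]; simp [mul_assoc]

theorem closure_stab_pos {m : ℕ} (β : Braid m) :
    closure (addStrand m β * sigma (Fin.last m)) = closure β :=
  (Quot.sound (MarkovMove.stab_pos m β)).symm

theorem closure_stab_neg {m : ℕ} (β : Braid m) :
    closure (addStrand m β * (sigma (Fin.last m))⁻¹) = closure β :=
  (Quot.sound (MarkovMove.stab_neg m β)).symm

/-- The unknot, as the closure of the one-strand braid. -/
def unknot : OrientedLink := closure (1 : Braid 0)

/-! ### Number of components -/

/-- The number of orbits of a permutation (fixed points included): the number of classes of the
equivalence relation generated by `x ∼ π x`. -/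
noncomputable def orbitCount {α : Type*} (π : Equiv.Perm α) : ℕ :=
  Nat.card (Quot fun x y : α => π x = y)

theorem orbitCount_conj {α : Type*} (γ π : Equiv.Perm α) :
    orbitCount (γ * π * γ⁻¹) = orbitCount π := by
  refine (Nat.card_congr (Quot.congr γ ?_)).symm
  intro a b
  simp

theorem perm_addStrand_castSucc {m : ℕ} (β : Braid m) (x : Fin (m + 1)) :
    perm (m + 1) (addStrand m β) x.castSucc = (perm m β x).castSucc := by
  have key : ∀ β : Braid m, ∀ x, perm (m + 1) (addStrand m β) x.castSucc
      = (perm m β x).castSucc := by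
    intro β
    refine PresentedGroup.generated_by (artinRels m)
      { carrier := {β | ∀ x, perm (m + 1) (addStrand m β) x.castSucc = (perm m β x).castSucc}
        mul_mem' := ?_, one_mem' := ?_, inv_mem' := ?_ } ?_ β
    · intro a b ha hb x
      simp only [Set.mem_ofPred_eq] at ha hb
      simp [ha, hb]
    · intro x; simp
    · intro a ha x
      simp only [Set.mem_ofPred_eq] at ha
      rw [map_inv, map_inv, Equiv.Perm.inv_eq_iff_eq, ha, map_inv]
      simp
    · intro i x
      change perm (m + 1) (addStrand m (sigma i)) x.castSucc = (perm m (sigma i) x).castSucc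
      rw [addStrand_sigma, perm_sigma, perm_sigma]
      simp only [Equiv.swap_apply_def, Fin.ext_iff]
      split_ifs <;> simp_all
  exact key β x

theorem perm_addStrand_last {m : ℕ} (β : Braid m) :
    perm (m + 1) (addStrand m β) (Fin.last (m + 1)) = Fin.last (m + 1) := by
  by_contra h
  obtain ⟨y, hy⟩ := Fin.exists_castSucc_eq.2 h
  have h2 := perm_addStrand_castSucc β ((perm m β)⁻¹ y)
  rw [← Equiv.Perm.mul_apply, mul_inv_cancel, Equiv.Perm.one_apply, hy] at h2
  exact (Fin.castSucc_lt_last _).ne ((perm (m + 1) (addStrand m β)).injective h2)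

theorem orbitCount_stab {m : ℕ} (β : Braid m) :
    orbitCount (perm (m + 1) (addStrand m β) *
      Equiv.swap (Fin.last m).castSucc (Fin.last (m + 1))) = orbitCount (perm m β) := by
  set π := perm (m + 1) (addStrand m β) *
      Equiv.swap (Fin.last m).castSucc (Fin.last (m + 1)) with hπ
  have e1 : π (Fin.last m).castSucc = Fin.last (m + 1) := by
    simp [hπ, perm_addStrand_last]
  have e2 : π (Fin.last (m + 1)) = (perm m β (Fin.last m)).castSucc := by
    simp only [hπ, Equiv.Perm.mul_apply, Equiv.swap_apply_right, perm_addStrand_castSucc]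
  have e3 : ∀ x : Fin (m + 1), x ≠ Fin.last m → π x.castSucc = (perm m β x).castSucc := by
    intro x hx
    rw [hπ, Equiv.Perm.mul_apply, Equiv.swap_apply_of_ne_of_ne, perm_addStrand_castSucc]
    · simpa using hx
    · exact (Fin.castSucc_lt_last _).ne
  let r : Fin (m + 2) → Fin (m + 1) := Fin.lastCases (Fin.last m) id
  have r1 : ∀ x : Fin (m + 1), r x.castSucc = x := fun x => by simp [r]
  have r2 : r (Fin.last (m + 1)) = Fin.last m := by simp [r]
  have q : ∀ x, Quot.mk (fun a b => π a = b) x = Quot.mk _ (π x) := fun x => Quot.sound rfl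
  refine (Nat.card_congr
    { toFun := Quot.lift (fun x => Quot.mk _ x.castSucc) ?_
      invFun := Quot.lift (fun x => Quot.mk _ (r x)) ?_
      left_inv := ?_
      right_inv := ?_ }).symm
  · rintro x y rfl
    by_cases hx : x = Fin.last m
    · subst hx
      exact (e1 ▸ q _).trans (e2 ▸ q _)
    · exact e3 x hx ▸ q _
  · rintro x y rfl
    refine Fin.lastCases ?_ (fun x => ?_) x
    · rw [r2, e2, r1]; exact Quot.sound rfl
    · by_cases hx : x = Fin.last m
      · subst hx; rw [e1, r1, r2]
      · rw [e3 x hx, r1, r1]; exact Quot.sound rfl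
  · rintro ⟨x⟩
    simp [r1]
  · rintro ⟨x⟩
    change Quot.mk _ (r x).castSucc = Quot.mk _ x
    refine Fin.lastCases ?_ (fun x => ?_) x
    · rw [r2]; exact e1 ▸ q _
    · rw [r1]

/-- The number of components of a link: for a closed braid, the number of orbits of its
permutation on the strands. -/
noncomputable def components : OrientedLink → ℕ :=
  Quot.lift (fun b => orbitCount (perm b.1 b.2)) (by
    rintro _ _ (⟨m, α, β⟩ | ⟨m, β⟩ | ⟨m, β⟩)
    · simp [orbitCount_conj]
    · simpa using (orbitCount_stab β).symm
    · simpa using (orbitCount_stab β).symm)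

/-! ### The HOMFLY polynomial -/

/-- Laurent polynomials in `v` and `z` with integer coefficients: Laurent polynomials in `z`
whose coefficients are Laurent polynomials in `v`. -/
abbrev VZ : Type := ℤ[T;T⁻¹][T;T⁻¹]

/-- The power `v ^ k`. -/
noncomputable def vPow (k : ℤ) : VZ := LaurentPolynomial.C (LaurentPolynomial.T k)

/-- The power `z ^ k`. -/
noncomputable def zPow (k : ℤ) : VZ := LaurentPolynomial.T k

/-- The defining properties of the HOMFLY polynomial: it is an invariant of oriented links with
value `1` on the unknot, and it satisfies the skein relation
`v⁻¹ P(L₊) - v P(L₋) = z P(L₀)`, where `L₊, L₋, L₀` are closed braids that differ in one place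
only, in which they have a positive crossing, a negative crossing and no crossing. -/
structure IsHomfly (P : OrientedLink → VZ) : Prop where
  unknot : P unknot = 1
  skein : ∀ (m : ℕ) (α β : Braid m) (i : Fin m),
    vPow (-1) * P (closure (α * sigma i * β)) - vPow 1 * P (closure (α * (sigma i)⁻¹ * β))
      = zPow 1 * P (closure (α * β))

/-! ### A skein theory is determined by the unknot -/

theorem braid_induction {m : ℕ} {C : Braid m → Prop} (one : C 1)
    (mul : ∀ β i, C β → C (β * sigma i)) (inv : ∀ β i, C β → C (β * (sigma i)⁻¹))
    (β : Braid m) : C β := by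
  have h : β ∈ Subgroup.closure (Set.range (PresentedGroup.of (rels := artinRels m))) := by
    rw [PresentedGroup.closure_range_of]; trivial
  induction h using Subgroup.closure_induction_right with
  | one => exact one
  | mul_right x hx y hy ih => obtain ⟨i, rfl⟩ := hy; exact mul _ _ ih
  | mul_inv_cancel x hx y hy ih => obtain ⟨i, rfl⟩ := hy; exact inv _ _ ih

theorem commute_last {m : ℕ} (β : Braid m) :
    Commute (sigma (Fin.last (m + 1))) (addStrand (m + 1) (addStrand m β)) := by
  induction β using braid_induction with
  | one => simp
  | mul β i ih =>
    rw [map_mul, map_mul]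
    refine ih.mul_right ?_
    rw [addStrand_sigma, addStrand_sigma]
    exact (sigma_comm _ _ (by simp)).symm
  | inv β i ih =>
    rw [map_mul, map_mul]
    refine ih.mul_right ?_
    rw [map_inv, map_inv, addStrand_sigma, addStrand_sigma]
    exact Commute.inv_right (sigma_comm _ _ (by simp)).symm

theorem vPow_mul (a b : ℤ) : vPow a * vPow b = vPow (a + b) := by
  rw [vPow, vPow, vPow, ← map_mul, ← LaurentPolynomial.T_add]

theorem zPow_mul (a b : ℤ) : zPow a * zPow b = zPow (a + b) := by
  rw [zPow, zPow, zPow, ← LaurentPolynomial.T_add]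

@[simp] theorem vPow_zero : vPow 0 = 1 := by simp [vPow]

@[simp] theorem zPow_zero : zPow 0 = 1 := by simp [zPow]

/-- The skein relation for a function on a braid group with values in a `VZ`-module. -/
def IsSkein {U : Type*} [AddCommGroup U] [Module VZ U] {m : ℕ} (f : Braid m → U) : Prop :=
  ∀ (α β : Braid m) (i : Fin m),
    vPow (-1) • f (α * sigma i * β) - vPow 1 • f (α * (sigma i)⁻¹ * β) = zPow 1 • f (α * β)

section span

variable {U : Type*} [AddCommGroup U] [Module VZ U]

theorem IsSkein.comp {m : ℕ} {f : Braid m → U} (hf : IsSkein f) (γ δ : Braid m) :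
    IsSkein (fun x => f (γ * x * δ)) := by
  intro α β i
  simpa [mul_assoc] using hf (γ * α) (β * δ) i

theorem IsSkein.pos {m : ℕ} {f : Braid m → U} (hf : IsSkein f) (α β : Braid m) (i : Fin m) :
    f (α * sigma i * β) = vPow 2 • f (α * (sigma i)⁻¹ * β) + (vPow 1 * zPow 1) • f (α * β) := by
  have h := congrArg (vPow 1 • ·) (hf α β i)
  simp only [smul_sub, smul_smul, vPow_mul] at h
  norm_num at h
  rw [← h]; abel

theorem IsSkein.neg {m : ℕ} {f : Braid m → U} (hf : IsSkein f) (α β : Braid m) (i : Fin m) :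
    f (α * (sigma i)⁻¹ * β)
      = vPow (-2) • f (α * sigma i * β) - (vPow (-1) * zPow 1) • f (α * β) := by
  have h := congrArg (vPow (-1) • ·) (hf α β i)
  simp only [smul_sub, smul_smul, vPow_mul] at h
  norm_num at h
  rw [← h]; abel

/-- The span of the values at braids `a` and `a t b`, where `a, b` do not involve the last strand
and `t` is the last generator. -/
noncomputable def spanSet {m : ℕ} (f : Braid (m + 1) → U) : Submodule VZ U :=
  Submodule.span VZ (Set.range (fun a : Braid m => f (addStrand m a)) ∪
    Set.range (fun p : Braid m × Braid m =>
      f (addStrand m p.1 * sigma (Fin.last m) * addStrand m p.2)))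

theorem mem_spanSet_one {m : ℕ} (f : Braid (m + 1) → U) (a : Braid m) :
    f (addStrand m a) ∈ spanSet f :=
  Submodule.subset_span (Or.inl ⟨a, rfl⟩)

theorem mem_spanSet_two {m : ℕ} (f : Braid (m + 1) → U) (a b : Braid m) :
    f (addStrand m a * sigma (Fin.last m) * addStrand m b) ∈ spanSet f :=
  Submodule.subset_span (Or.inr ⟨(a, b), rfl⟩)

theorem mem_spanSet_sq {m : ℕ} {f : Braid (m + 1) → U} (hf : IsSkein f) (a b : Braid m) :
    f (addStrand m a * sigma (Fin.last m) * (sigma (Fin.last m) * addStrand m b))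
      ∈ spanSet f := by
  rw [hf.pos]
  refine add_mem (Submodule.smul_mem _ _ ?_) (Submodule.smul_mem _ _ ?_)
  · simpa [mul_assoc] using mem_spanSet_one f (a * b)
  · simpa [mul_assoc] using mem_spanSet_two f a b

theorem spanSet_step {m : ℕ} {f : Braid (m + 1) → U}
    (hlast : ∀ a b : Braid m, f (addStrand m a * sigma (Fin.last m) * addStrand m b *
      sigma (Fin.last m)) ∈ spanSet f) (i : Fin (m + 1)) :
    spanSet (fun x => f (x * sigma i)) ≤ spanSet f := by
  refine Submodule.span_le.2 ?_
  rintro _ (⟨a, rfl⟩ | ⟨⟨a, b⟩, rfl⟩)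
  · refine Fin.lastCases ?_ (fun i => ?_) i
    · simpa using mem_spanSet_two f a 1
    · simpa using mem_spanSet_one f (a * sigma i)
  · refine Fin.lastCases ?_ (fun i => ?_) i
    · exact hlast a b
    · simpa [mul_assoc] using mem_spanSet_two f a (b * sigma i)

theorem mem_spanSet_of_last {m : ℕ}
    (hlast : ∀ f : Braid (m + 1) → U, IsSkein f → ∀ a b : Braid m,
      f (addStrand m a * sigma (Fin.last m) * addStrand m b * sigma (Fin.last m)) ∈ spanSet f)
    (β : Braid (m + 1)) : ∀ f : Braid (m + 1) → U, IsSkein f → f β ∈ spanSet f := by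
  have key : ∀ (β : Braid (m + 1)) (i : Fin (m + 1)),
      (∀ f : Braid (m + 1) → U, IsSkein f → f β ∈ spanSet f) →
      ∀ f : Braid (m + 1) → U, IsSkein f → f (β * sigma i) ∈ spanSet f := by
    intro β i ih f hf
    refine spanSet_step (hlast f hf) i (ih (fun x => f (x * sigma i)) ?_)
    simpa using hf.comp 1 (sigma i)
  induction β using braid_induction with
  | one => intro f hf; simpa using mem_spanSet_one f 1
  | mul β i ih => exact key β i ih
  | inv β i ih =>
    intro f hf
    have h := hf.neg β 1 i
    simp only [mul_one] at h
    rw [h]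
    exact sub_mem (Submodule.smul_mem _ _ (key β i ih f hf)) (Submodule.smul_mem _ _ (ih f hf))

theorem braid_zero_eq_one (β : Braid 0) : β = 1 := by
  induction β using braid_induction with
  | one => rfl
  | mul β i ih => exact i.elim0
  | inv β i ih => exact i.elim0

theorem mem_spanSet (m : ℕ) :
    ∀ (β : Braid (m + 1)) (f : Braid (m + 1) → U), IsSkein f → f β ∈ spanSet f := by
  induction m with
  | zero =>
    refine mem_spanSet_of_last fun f hf a b => ?_
    rw [braid_zero_eq_one b]
    simpa [mul_assoc] using mem_spanSet_sq hf a 1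
  | succ m ih =>
    refine mem_spanSet_of_last fun f hf a b => ?_
    obtain ⟨g, hgf⟩ : ∃ g : Braid (m + 1) → U, ∀ x, g x =
        f (addStrand (m + 1) a * sigma (Fin.last (m + 1)) * addStrand (m + 1) x *
          sigma (Fin.last (m + 1))) := ⟨_, fun _ => rfl⟩
    have hg : IsSkein g := by
      intro α β i
      simpa [hgf, mul_assoc] using hf (addStrand (m + 1) a * sigma (Fin.last (m + 1)) *
        addStrand (m + 1) α) (addStrand (m + 1) β * sigma (Fin.last (m + 1))) i.castSucc
    rw [← hgf]
    have hle : spanSet g ≤ spanSet f := by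
      refine Submodule.span_le.2 ?_
      rintro _ (⟨x, rfl⟩ | ⟨⟨x, y⟩, rfl⟩)
      · have e : addStrand (m + 1) a * sigma (Fin.last (m + 1)) *
            addStrand (m + 1) (addStrand m x) * sigma (Fin.last (m + 1)) =
            addStrand (m + 1) a * sigma (Fin.last (m + 1)) *
            (sigma (Fin.last (m + 1)) * addStrand (m + 1) (addStrand m x)) := by
          rw [(commute_last x).eq, mul_assoc]
        simp only [SetLike.mem_coe, hgf]
        rw [e]
        exact mem_spanSet_sq hf _ _
      · have hb : sigma (Fin.last m).castSucc * sigma (Fin.last (m + 1)) *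
            sigma (Fin.last m).castSucc = sigma (Fin.last (m + 1)) * sigma (Fin.last m).castSucc *
            sigma (Fin.last (m + 1)) := sigma_braid _ _ (by simp)
        have e : addStrand (m + 1) a * sigma (Fin.last (m + 1)) *
            addStrand (m + 1) (addStrand m x * sigma (Fin.last m) * addStrand m y) *
            sigma (Fin.last (m + 1)) =
            addStrand (m + 1) (a * addStrand m x * sigma (Fin.last m)) * sigma (Fin.last (m + 1)) *
            addStrand (m + 1) (sigma (Fin.last m) * addStrand m y) := by
          simp only [map_mul, addStrand_sigma]
          calc _ = addStrand (m + 1) a * (sigma (Fin.last (m + 1)) *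
                addStrand (m + 1) (addStrand m x)) * sigma (Fin.last m).castSucc *
                (addStrand (m + 1) (addStrand m y) * sigma (Fin.last (m + 1))) := by
                simp only [mul_assoc]
            _ = addStrand (m + 1) a * addStrand (m + 1) (addStrand m x) * (sigma (Fin.last (m + 1)) *
                sigma (Fin.last m).castSucc * sigma (Fin.last (m + 1))) *
                addStrand (m + 1) (addStrand m y) := by
                rw [(commute_last x).eq, ← (commute_last y).eq]; simp only [mul_assoc]
            _ = _ := by rw [← hb]; simp only [mul_assoc]
        simp only [SetLike.mem_coe, hgf]
        rw [e]
        exact mem_spanSet_two f _ _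
    exact hle (ih b g hg)

end span

/-! ### A numerical Markov invariant from an `R`-matrix -/

section RMatrix

variable (N : ℕ) (q : ℝ)

/-- Functions on the colourings of `m + 1` strands by `N + 1` colours. -/
abbrev ColSpace (m : ℕ) : Type := (Fin (m + 1) → Fin (N + 1)) → ℝ

/-- The action of a crossing on functions on colourings. -/
noncomputable def rOp {m : ℕ} (i : Fin m) : Module.End ℝ (ColSpace N m) where
  toFun f c := (if c i.castSucc = c i.succ then q * f c
      else f (c ∘ Equiv.swap i.castSucc i.succ)) +
    if c i.castSucc < c i.succ then (q - q⁻¹) * f c else 0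
  map_add' f g := by
    ext c
    simp only [Pi.add_apply]
    split_ifs <;> ring
  map_smul' a f := by
    ext c
    simp only [Pi.smul_apply, smul_eq_mul, RingHom.id_apply]
    split_ifs <;> ring

theorem rOp_apply {m : ℕ} (i : Fin m) (f : ColSpace N m) (c : Fin (m + 1) → Fin (N + 1)) :
    rOp N q i f c = (if c i.castSucc = c i.succ then q * f c
      else f (c ∘ Equiv.swap i.castSucc i.succ)) +
    if c i.castSucc < c i.succ then (q - q⁻¹) * f c else 0 := rfl

theorem swap_swap_comp {m : ℕ} {κ : Type*} (c : Fin m → κ) (a b : Fin m) :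
    (c ∘ Equiv.swap a b) ∘ Equiv.swap a b = c := by
  ext x; simp

variable {q}

theorem rOp_sq (hq : q ≠ 0) {m : ℕ} (i : Fin m) :
    rOp N q i * rOp N q i = 1 + (q - q⁻¹) • rOp N q i := by
  refine LinearMap.ext fun f => ?_
  funext c
  have e : q * q = 1 + (q - q⁻¹) * q := by field_simp; ring
  simp only [Module.End.mul_apply, LinearMap.add_apply, Module.End.one_apply, LinearMap.smul_apply,
    Pi.add_apply, Pi.smul_apply, smul_eq_mul, rOp_apply, swap_swap_comp, Function.comp_apply,
    Equiv.swap_apply_left, Equiv.swap_apply_right]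
  rcases lt_trichotomy (c i.castSucc) (c i.succ) with h | h | h
  · simp [h, h.ne, h.ne', h.not_gt]
  · simp only [h, if_true, lt_irrefl, if_false]
    linear_combination e * f c
  · simp [h, h.ne, h.ne', h.not_gt]

variable (q)

theorem rOp_comm {m : ℕ} (i j : Fin m) (h : (i : ℕ) + 1 < j) :
    rOp N q i * rOp N q j = rOp N q j * rOp N q i := by
  have a1 : i.castSucc ≠ j.castSucc := by simp [Fin.ext_iff]; omega
  have a2 : i.castSucc ≠ j.succ := by simp [Fin.ext_iff]; omega
  have a3 : i.succ ≠ j.castSucc := by simp [Fin.ext_iff]; omega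
  have a4 : i.succ ≠ j.succ := by simp [Fin.ext_iff]; omega
  refine LinearMap.ext fun f => ?_
  funext c
  have e : (c ∘ Equiv.swap i.castSucc i.succ) ∘ Equiv.swap j.castSucc j.succ =
      (c ∘ Equiv.swap j.castSucc j.succ) ∘ Equiv.swap i.castSucc i.succ := by
    have := (Equiv.Perm.Disjoint.commute (Equiv.Perm.disjoint_swap_swap
      (x := i.castSucc) (y := i.succ) (z := j.castSucc) (t := j.succ) (by
        have b1 : i.castSucc ≠ i.succ := by simp [Fin.ext_iff]
        have b2 : j.castSucc ≠ j.succ := by simp [Fin.ext_iff]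
        simp [a1, a2, a3, a4, b1, b2]))).eq
    ext x
    simp only [Function.comp_apply, ← Equiv.Perm.mul_apply, this]
  simp only [Module.End.mul_apply, rOp_apply, Function.comp_apply, e,
    Equiv.swap_apply_of_ne_of_ne a1.symm a3.symm, Equiv.swap_apply_of_ne_of_ne a2.symm a4.symm,
    Equiv.swap_apply_of_ne_of_ne a1 a2, Equiv.swap_apply_of_ne_of_ne a3 a4]
  split_ifs <;> ring

variable {q}

theorem rOp_braid (hq : q ≠ 0) {m : ℕ} (i j : Fin m) (h : (i : ℕ) + 1 = j) :
    rOp N q i * rOp N q j * rOp N q i = rOp N q j * rOp N q i * rOp N q j := by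
  have ej : j.castSucc = i.succ := by simp [Fin.ext_iff, ← h]
  have e1 : i.castSucc ≠ i.succ := by simp [Fin.ext_iff]
  have e2 : i.castSucc ≠ j.succ := by simp [Fin.ext_iff]; omega
  have e3 : i.succ ≠ j.succ := by simp [Fin.ext_iff]; omega
  refine LinearMap.ext fun f => ?_
  funext c
  let up : Fin (N + 1) → Fin (N + 1) → Fin (N + 1) → (Fin (m + 1) → Fin (N + 1)) := fun x y w =>
    Function.update (Function.update (Function.update c i.castSucc x) i.succ y) j.succ w
  have u1 : ∀ x y w, up x y w i.castSucc = x := by intro x y w; simp [up, e1, e2]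
  have u2 : ∀ x y w, up x y w i.succ = y := by intro x y w; simp [up, e3]
  have u3 : ∀ x y w, up x y w j.succ = w := by intro x y w; simp [up]
  have s1 : ∀ x y w, up x y w ∘ Equiv.swap i.castSucc i.succ = up y x w := by
    intro x y w
    funext k
    simp only [Function.comp_apply, Equiv.swap_apply_def]
    split_ifs with h1 h2
    · subst h1; rw [u1, u2]
    · subst h2; rw [u1, u2]
    · simp [up, Function.update_apply, h1, h2]
  have s2 : ∀ x y w, up x y w ∘ Equiv.swap i.succ j.succ = up x w y := by
    intro x y w
    funext k
    simp only [Function.comp_apply, Equiv.swap_apply_def]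
    split_ifs with h1 h2
    · subst h1; rw [u3, u2]
    · subst h2; rw [u3, u2]
    · simp [up, Function.update_apply, h1, h2]
  have r1 : ∀ (g : ColSpace N m) x y w, rOp N q i g (up x y w) =
      (if x = y then q * g (up x y w) else g (up y x w)) +
        if x < y then (q - q⁻¹) * g (up x y w) else 0 := by
    intro g x y w; rw [rOp_apply, u1, u2, s1]
  have r2 : ∀ (g : ColSpace N m) x y w, rOp N q j g (up x y w) =
      (if y = w then q * g (up x y w) else g (up x w y)) +
        if y < w then (q - q⁻¹) * g (up x y w) else 0 := by
    intro g x y w; rw [rOp_apply, ej, u2, u3, s2]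
  have hc : c = up (c i.castSucc) (c i.succ) (c j.succ) := by simp [up]
  rw [hc]
  generalize c i.castSucc = x
  generalize c i.succ = y
  generalize c j.succ = w
  have e : q * q = 1 + (q - q⁻¹) * q := by field_simp; ring
  simp only [Module.End.mul_apply, r1, r2]
  rcases lt_trichotomy x y with hxy | hxy | hxy <;> rcases lt_trichotomy y w with hyw | hyw | hyw <;>
    rcases lt_trichotomy x w with hxw | hxw | hxw <;>
    first
    | (exfalso; omega)
    | (try subst hxy
       try subst hyw
       try subst hxw
       simp only [*, lt_irrefl, if_true, if_false, ne_of_lt, ne_of_gt, not_lt_of_gt]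
       all_goals first
       | ring1
       | (field_simp; ring1))

/-- The weight of a colour. -/
noncomputable def wt (q : ℝ) (j : Fin (N + 1)) : ℝ := q ^ (2 * (j : ℕ)) / q ^ N

/-- The weight of a colouring. -/
noncomputable def wtProd (q : ℝ) {m : ℕ} (c : Fin (m + 1) → Fin (N + 1)) : ℝ := ∏ k, wt N q (c k)

theorem sum_wt_entry (hq : q ≠ 0) (i : Fin (N + 1)) :
    ∑ j : Fin (N + 1), wt N q j * ((if i = j then q else 0) + if i < j then q - q⁻¹ else 0)
      = q ^ (N + 1) := by
  have h : ∀ (N i : ℕ), i ≤ N → ∑ j ∈ Finset.range (N + 1), q ^ (2 * j) *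
      ((if i = j then q else 0) + if i < j then q - q⁻¹ else 0) = q ^ (2 * N + 1) := by
    intro N
    induction N with
    | zero => intro i hi; obtain rfl : i = 0 := by omega
              simp
    | succ N ih =>
      intro i hi
      rw [Finset.sum_range_succ]
      rcases Nat.lt_or_ge N i with h | h
      · obtain rfl : i = N + 1 := by omega
        rw [Finset.sum_eq_zero]
        · simp; ring
        · intro j hj
          have := Finset.mem_range.1 hj
          rw [if_neg (by omega), if_neg (by omega)]; simp
      · rw [ih i h, if_neg (by omega), if_pos (by omega)]
        field_simp
        ring
  have h2 := h N i (by omega)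
  rw [← Fin.sum_univ_eq_sum_range (fun j => q ^ (2 * j) *
      ((if (i : ℕ) = j then q else 0) + if (i : ℕ) < j then q - q⁻¹ else 0)) (N + 1)] at h2
  have h3 : q ^ (N + 1) = q ^ (2 * N + 1) / q ^ N := by field_simp; ring
  rw [h3, ← h2, Finset.sum_div]
  refine Finset.sum_congr rfl fun j _ => ?_
  simp only [wt, Fin.ext_iff, Fin.lt_def]
  ring

theorem sum_wt (hq : q ≠ 0) :
    (q - q⁻¹) * ∑ j : Fin (N + 1), wt N q j = q ^ (N + 1) - (q ^ (N + 1))⁻¹ := by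
  have h : ∀ N : ℕ, (q - q⁻¹) * ∑ j ∈ Finset.range (N + 1), q ^ (2 * j) = q ^ (2 * N + 1) - q⁻¹ := by
    intro N
    induction N with
    | zero => simp
    | succ N ih => rw [Finset.sum_range_succ, mul_add, ih]; field_simp; ring
  have h2 := h N
  rw [← Fin.sum_univ_eq_sum_range (fun j => q ^ (2 * j)) (N + 1)] at h2
  simp only [wt, ← Finset.sum_div]
  rw [← mul_div_assoc, h2]
  field_simp
  ring

theorem sum_wt_pos (hq : 0 < q) : 0 < ∑ j : Fin (N + 1), wt N q j :=
  Finset.sum_pos (fun j _ => by unfold wt; positivity) Finset.univ_nonempty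

/-- The rescaled action of a crossing, as an invertible operator. -/
noncomputable def tOp (hq : q ≠ 0) {m : ℕ} (i : Fin m) : (Module.End ℝ (ColSpace N m))ˣ where
  val := (q ^ (N + 1))⁻¹ • rOp N q i
  inv := q ^ (N + 1) • (rOp N q i - (q - q⁻¹) • 1)
  val_inv := by
    rw [smul_mul_smul_comm, inv_mul_cancel₀ (pow_ne_zero _ hq), one_smul, mul_sub, rOp_sq N hq,
      mul_smul_comm, mul_one, add_sub_cancel_right]
  inv_val := by
    rw [smul_mul_smul_comm, mul_inv_cancel₀ (pow_ne_zero _ hq), one_smul, sub_mul, rOp_sq N hq,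
      smul_mul_assoc, one_mul, add_sub_cancel_right]

/-- The representation of the braid group on functions on colourings. -/
noncomputable def rep (hq : q ≠ 0) (m : ℕ) : Braid m →* (Module.End ℝ (ColSpace N m))ˣ :=
  lift (tOp N hq)
    (fun i j h => by
      ext1
      simp only [tOp, Units.val_mul, smul_mul_smul_comm, rOp_comm N q i j h])
    (fun i j h => by
      ext1
      simp only [tOp, Units.val_mul, smul_mul_smul_comm, rOp_braid N hq i j h])

@[simp] theorem rep_sigma (hq : q ≠ 0) {m : ℕ} (i : Fin m) :
    rep N hq m (sigma i) = tOp N hq i := by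
  simp [rep]

/-- Multiplication by the weight. -/
noncomputable def wtOp (q : ℝ) (m : ℕ) : Module.End ℝ (ColSpace N m) where
  toFun f c := wtProd N q c * f c
  map_add' f g := by ext c; simp [mul_add]
  map_smul' a f := by ext c; simp; ring

theorem wtOp_comm_rOp {m : ℕ} (i : Fin m) : Commute (wtOp N q m) (rOp N q i) := by
  refine LinearMap.ext fun f => ?_
  funext c
  have e : wtProd N q (c ∘ Equiv.swap i.castSucc i.succ) = wtProd N q c :=
    Equiv.prod_comp (Equiv.swap i.castSucc i.succ) (fun k => wt N q (c k))
  simp only [Module.End.mul_apply, rOp_apply, wtOp, LinearMap.coe_mk, AddHom.coe_mk, e]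
  split_ifs <;> ring

theorem wtOp_comm_rep (hq : q ≠ 0) {m : ℕ} (β : Braid m) :
    Commute (wtOp N q m) (rep N hq m β : Module.End ℝ (ColSpace N m)) := by
  have key : ∀ i : Fin m, Commute (wtOp N q m) (tOp N hq i : Module.End ℝ (ColSpace N m)) :=
    fun i => (wtOp_comm_rOp N i).smul_right _
  induction β using braid_induction with
  | one => simp
  | mul β i ih =>
    rw [map_mul, Units.val_mul, rep_sigma]; exact ih.mul_right (key i)
  | inv β i ih =>
    rw [map_mul, Units.val_mul, map_inv, rep_sigma]; exact ih.mul_right (key i).units_inv_right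

/-- The weighted trace. -/
noncomputable def wtTrace (q : ℝ) {m : ℕ} (A : Module.End ℝ (ColSpace N m)) : ℝ :=
  LinearMap.trace ℝ _ (wtOp N q m * A)

theorem wtTrace_eq_sum (q : ℝ) {m : ℕ} (A : Module.End ℝ (ColSpace N m)) :
    wtTrace N q A = ∑ c, wtProd N q c * A (Pi.single c 1) c := by
  rw [wtTrace, LinearMap.trace_eq_matrix_trace ℝ (Pi.basisFun ℝ _), Matrix.trace]
  refine Finset.sum_congr rfl fun c _ => ?_
  simp [wtOp]

theorem wtTrace_conj (hq : q ≠ 0) {m : ℕ} (α β : Braid m) :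
    wtTrace N q (rep N hq m (α * β * α⁻¹)).val = wtTrace N q (rep N hq m β).val := by
  rw [wtTrace, wtTrace, map_mul (rep N hq m), map_mul (rep N hq m), Units.val_mul, Units.val_mul,
    mul_assoc, ← mul_assoc,
    (wtOp_comm_rep N hq α).eq, mul_assoc, LinearMap.trace_mul_comm, mul_assoc, mul_assoc, map_inv,
    Units.inv_mul, mul_one]

/-- Restriction to the colourings with a given colour of the last strand. -/
def slice (m : ℕ) (d : Fin (N + 1)) : ColSpace N (m + 1) →ₗ[ℝ] ColSpace N m where
  toFun f c := f (Fin.snoc (α := fun _ => Fin (N + 1)) c d)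
  map_add' _ _ := rfl
  map_smul' _ _ := rfl

theorem slice_rOp {m : ℕ} (i : Fin m) (d : Fin (N + 1)) :
    slice N m d ∘ₗ rOp N q i.castSucc = rOp N q i ∘ₗ slice N m d := by
  refine LinearMap.ext fun f => ?_
  funext c
  have e : (Fin.snoc (α := fun _ => Fin (N + 1)) c d) ∘ Equiv.swap i.castSucc.castSucc
      i.castSucc.succ = Fin.snoc (α := fun _ => Fin (N + 1))
        (c ∘ Equiv.swap i.castSucc i.succ) d := by
    funext k
    refine Fin.lastCases ?_ (fun k => ?_) k
    · rw [Function.comp_apply, Equiv.swap_apply_of_ne_of_ne]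
      · simp
      · exact (Fin.castSucc_lt_last _).ne'
      · rw [← Fin.castSucc_succ]; exact (Fin.castSucc_lt_last _).ne'
    · rw [Fin.snoc_castSucc, Function.comp_apply, Function.comp_apply, Equiv.swap_apply_def,
        Equiv.swap_apply_def]
      simp only [← Fin.castSucc_succ, Fin.castSucc_inj]
      split_ifs <;> simp only [Fin.snoc_castSucc]
  simp only [LinearMap.comp_apply, rOp_apply, slice, LinearMap.coe_mk, AddHom.coe_mk, e]
  simp only [← Fin.castSucc_succ, Fin.snoc_castSucc]

theorem slice_rep (hq : q ≠ 0) {m : ℕ} (β : Braid m) (d : Fin (N + 1)) :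
    slice N m d ∘ₗ (rep N hq (m + 1) (addStrand m β)).val
      = (rep N hq m β).val ∘ₗ slice N m d := by
  induction β using braid_induction with
  | one => ext; simp
  | mul β i ih =>
    rw [map_mul, map_mul, map_mul, addStrand_sigma, rep_sigma, rep_sigma, Units.val_mul,
      Units.val_mul, Module.End.mul_eq_comp, Module.End.mul_eq_comp, ← LinearMap.comp_assoc, ih,
      LinearMap.comp_assoc, LinearMap.comp_assoc]
    congr 1
    simp only [tOp, LinearMap.comp_smul, LinearMap.smul_comp, slice_rOp]
  | inv β i ih =>
    rw [map_mul, map_mul, map_mul, map_inv, map_inv, map_inv, addStrand_sigma, rep_sigma, rep_sigma,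
      Units.val_mul, Units.val_mul, Module.End.mul_eq_comp, Module.End.mul_eq_comp,
      ← LinearMap.comp_assoc, ih, LinearMap.comp_assoc, LinearMap.comp_assoc]
    congr 1
    simp only [tOp, Units.inv_mk, LinearMap.comp_smul, LinearMap.smul_comp, LinearMap.comp_sub,
      LinearMap.sub_comp, slice_rOp]
    rfl

theorem wtProd_snoc (q : ℝ) {m : ℕ} (c : Fin (m + 1) → Fin (N + 1)) (d : Fin (N + 1)) :
    wtProd N q (Fin.snoc (α := fun _ => Fin (N + 1)) c d) = wtProd N q c * wt N q d := by
  simp [wtProd, Fin.prod_univ_castSucc (n := m + 1)]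

theorem sum_snoc {m : ℕ} (g : (Fin (m + 2) → Fin (N + 1)) → ℝ) :
    ∑ c, g c = ∑ c : Fin (m + 1) → Fin (N + 1), ∑ d,
      g (Fin.snoc (α := fun _ => Fin (N + 1)) c d) := by
  rw [← (Fin.snocEquiv (fun _ : Fin (m + 2) => Fin (N + 1))).sum_comp, Fintype.sum_prod_type_right]
  rfl

theorem slice_single {m : ℕ} (c : Fin (m + 1) → Fin (N + 1)) (d : Fin (N + 1)) :
    slice N m d (Pi.single (Fin.snoc (α := fun _ => Fin (N + 1)) c d) 1) = Pi.single c 1 := by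
  funext c'
  simp only [slice, LinearMap.coe_mk, AddHom.coe_mk, Pi.single_apply]
  congr 1
  simp [Fin.snoc_inj]

theorem slice_rOp_single {m : ℕ} (c : Fin (m + 1) → Fin (N + 1)) (d : Fin (N + 1)) :
    slice N m d (rOp N q (Fin.last m) (Pi.single (Fin.snoc (α := fun _ => Fin (N + 1)) c d) 1)) =
      ((if c (Fin.last m) = d then q else 0) + if c (Fin.last m) < d then q - q⁻¹ else 0) •
        Pi.single c 1 := by
  funext c'
  have hl : (Fin.last m).succ = Fin.last (m + 1) := rfl
  simp only [slice, LinearMap.coe_mk, AddHom.coe_mk, rOp_apply, Fin.snoc_castSucc, hl,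
    Fin.snoc_last, Pi.smul_apply, smul_eq_mul, Pi.single_apply, Fin.snoc_inj, and_true]
  by_cases h : c' = c
  · subst h
    by_cases h1 : c' (Fin.last m) = d
    · simp [h1]
    · have : (Fin.snoc (α := fun _ => Fin (N + 1)) c' d) ∘ Equiv.swap (Fin.last m).castSucc
          (Fin.last (m + 1)) ≠ Fin.snoc (α := fun _ => Fin (N + 1)) c' d := by
        intro h2
        have h3 := congrFun h2 (Fin.last (m + 1))
        simp at h3
        exact h1 h3
      simp [h1, this]
  · by_cases h1 : c' (Fin.last m) = d
    · simp [h, h1]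
    · have : (Fin.snoc (α := fun _ => Fin (N + 1)) c' d) ∘ Equiv.swap (Fin.last m).castSucc
          (Fin.last (m + 1)) ≠ Fin.snoc (α := fun _ => Fin (N + 1)) c d := by
        intro h2
        have h3 := congrFun h2 (Fin.last (m + 1))
        simp at h3
        exact h1 h3
      simp [h, h1, this]

theorem wtTrace_addStrand (hq : q ≠ 0) {m : ℕ} (β : Braid m) :
    wtTrace N q (rep N hq (m + 1) (addStrand m β)).val
      = (∑ j, wt N q j) * wtTrace N q (rep N hq m β).val := by
  rw [wtTrace_eq_sum, wtTrace_eq_sum, sum_snoc, Finset.mul_sum]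
  refine Finset.sum_congr rfl fun c _ => ?_
  rw [Finset.sum_mul]
  refine Finset.sum_congr rfl fun d _ => ?_
  have h := congrFun (LinearMap.congr_fun (slice_rep N hq β d)
    (Pi.single (Fin.snoc (α := fun _ => Fin (N + 1)) c d) 1)) c
  rw [LinearMap.comp_apply, LinearMap.comp_apply, slice_single] at h
  rw [← h, wtProd_snoc]
  simp only [slice, LinearMap.coe_mk, AddHom.coe_mk]
  ring

theorem wtTrace_addStrand_mul (hq : q ≠ 0) {m : ℕ} (β : Braid m) :
    wtTrace N q ((rep N hq (m + 1) (addStrand m β)).val * rOp N q (Fin.last m))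
      = q ^ (N + 1) * wtTrace N q (rep N hq m β).val := by
  rw [wtTrace_eq_sum, wtTrace_eq_sum, sum_snoc, Finset.mul_sum]
  refine Finset.sum_congr rfl fun c _ => ?_
  rw [← sum_wt_entry N hq (c (Fin.last m)), Finset.sum_mul]
  refine Finset.sum_congr rfl fun d _ => ?_
  have h := congrFun (LinearMap.congr_fun (slice_rep N hq β d)
    (rOp N q (Fin.last m) (Pi.single (Fin.snoc (α := fun _ => Fin (N + 1)) c d) 1))) c
  rw [LinearMap.comp_apply, LinearMap.comp_apply, slice_rOp_single, map_smul, Pi.smul_apply,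
    smul_eq_mul] at h
  rw [wtProd_snoc, Module.End.mul_apply]
  simp only [slice, LinearMap.coe_mk, AddHom.coe_mk] at h
  rw [h]
  ring

/-- The numerical link invariant given by the weighted trace. -/
noncomputable def numInv (hq : q ≠ 0) {m : ℕ} (β : Braid m) : ℝ :=
  wtTrace N q (rep N hq m β).val / ∑ j, wt N q j

theorem wtTrace_smul (q a : ℝ) {m : ℕ} (A : Module.End ℝ (ColSpace N m)) :
    wtTrace N q (a • A) = a * wtTrace N q A := by
  simp [wtTrace]

theorem wtTrace_sub (q : ℝ) {m : ℕ} (A B : Module.End ℝ (ColSpace N m)) :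
    wtTrace N q (A - B) = wtTrace N q A - wtTrace N q B := by
  simp [wtTrace, mul_sub]

theorem numInv_conj (hq : q ≠ 0) {m : ℕ} (α β : Braid m) :
    numInv N hq (α * β * α⁻¹) = numInv N hq β := by
  rw [numInv, wtTrace_conj, numInv]

theorem numInv_stab_pos (hq : q ≠ 0) {m : ℕ} (β : Braid m) :
    numInv N hq (addStrand m β * sigma (Fin.last m)) = numInv N hq β := by
  rw [numInv, numInv, map_mul, Units.val_mul, rep_sigma]
  simp only [tOp, mul_smul_comm, wtTrace_smul]
  rw [wtTrace_addStrand_mul, inv_mul_cancel_left₀ (pow_ne_zero _ hq)]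

theorem numInv_stab_neg (hq : q ≠ 0) {m : ℕ} (β : Braid m) :
    numInv N hq (addStrand m β * (sigma (Fin.last m))⁻¹) = numInv N hq β := by
  rw [numInv, numInv, map_mul, Units.val_mul, map_inv, rep_sigma]
  simp only [tOp, Units.inv_mk, mul_smul_comm, wtTrace_smul, mul_sub, wtTrace_sub, mul_one]
  rw [wtTrace_addStrand_mul, wtTrace_addStrand, ← mul_assoc (q - q⁻¹), sum_wt N hq, ← mul_sub,
    ← sub_mul, sub_sub_cancel, mul_inv_cancel_left₀ (pow_ne_zero _ hq)]

theorem numInv_one (hq : 0 < q) : numInv N hq.ne' (1 : Braid 0) = 1 := by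
  rw [numInv, div_eq_one_iff_eq (sum_wt_pos N hq).ne', wtTrace_eq_sum, map_one]
  rw [← (Equiv.funUnique (Fin 1) (Fin (N + 1))).sum_comp (wt N q)]
  exact Finset.sum_congr rfl fun c _ => by simp [wtProd]

theorem numInv_skein (hq : q ≠ 0) {m : ℕ} (α β : Braid m) (i : Fin m) :
    q ^ (N + 1) * numInv N hq (α * sigma i * β) - (q ^ (N + 1))⁻¹ *
      numInv N hq (α * (sigma i)⁻¹ * β) = (q - q⁻¹) * numInv N hq (α * β) := by
  have hu := pow_ne_zero (N + 1) hq
  have h0 : q ^ (N + 1) • (tOp N hq i).val - (q ^ (N + 1))⁻¹ • (tOp N hq i)⁻¹.val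
      = (q - q⁻¹) • 1 := by
    simp only [tOp, Units.inv_mk, smul_smul, mul_inv_cancel₀ hu, inv_mul_cancel₀ hu, one_smul,
      sub_sub_cancel]
  have h : q ^ (N + 1) • (rep N hq m (α * sigma i * β)).val - (q ^ (N + 1))⁻¹ •
      (rep N hq m (α * (sigma i)⁻¹ * β)).val = (q - q⁻¹) • (rep N hq m (α * β)).val := by
    have h1 := congrArg (fun X => (rep N hq m α).val * X * (rep N hq m β).val) h0
    simpa only [map_mul, map_inv, rep_sigma, Units.val_mul, mul_sub, sub_mul, mul_smul_comm,
      smul_mul_assoc, mul_one] using h1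
  have h2 := congrArg (wtTrace N q) h
  rw [wtTrace_sub, wtTrace_smul, wtTrace_smul, wtTrace_smul] at h2
  simp only [numInv, ← mul_div_assoc, ← sub_div, h2]

end RMatrix

/-! ### Existence and uniqueness of the HOMFLY polynomial -/

section evaluation

/-- The parameters: a number of colours (minus one) and a real number `q > 1`. -/
abbrev Param : Type := ℕ × {q : ℝ // 1 < q}

theorem Param.ne (k : Param) : (k.2 : ℝ) ≠ 0 := (zero_lt_one.trans k.2.2).ne'

theorem sub_inv_pos' {q : ℝ} (hq : 1 < q) : 0 < q - q⁻¹ :=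
  sub_pos.2 ((inv_lt_one_of_one_lt₀ hq).trans hq)

/-- Evaluation of a Laurent polynomial in `v, z` at non-zero real numbers. -/
noncomputable def evalAt (a b : ℝˣ) : VZ →+* ℝ :=
  LaurentPolynomial.eval₂ (LaurentPolynomial.eval₂ (Int.castRingHom ℝ) a) b

@[simp] theorem evalAt_vPow (a b : ℝˣ) (k : ℤ) : evalAt a b (vPow k) = ((a ^ k : ℝˣ) : ℝ) := by
  simp [evalAt, vPow]

@[simp] theorem evalAt_zPow (a b : ℝˣ) (k : ℤ) : evalAt a b (zPow k) = ((b ^ k : ℝˣ) : ℝ) := by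
  simp [evalAt, zPow]

theorem laurent_eq_zero {S : Type*} [CommRing S] (φ : S →+* ℝ) (f : S[T;T⁻¹]) (A : Set ℝˣ)
    (hA : A.Infinite) (h : ∀ a ∈ A, LaurentPolynomial.eval₂ φ a f = 0) (k : ℤ) :
    φ (f.coeff k) = 0 := by
  obtain ⟨n, p, hp⟩ := f.exists_T_pow
  have h1 : p.map φ = 0 := by
    refine Polynomial.eq_zero_of_infinite_isRoot _
      ((hA.image (Units.val_injective.injOn)).mono ?_)
    rintro _ ⟨a, ha, rfl⟩
    simp only [Set.mem_ofPred_eq, Polynomial.IsRoot, Polynomial.eval_map]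
    rw [← LaurentPolynomial.eval₂_toLaurent, hp, map_mul, h a ha, zero_mul]
  have h2 : ∀ i, φ (p.coeff i) = 0 := fun i => by rw [← Polynomial.coeff_map, h1]; rfl
  have h3 : f.coeff k = (f * LaurentPolynomial.T n).coeff (k + n) := by
    rw [LaurentPolynomial.T, AddMonoidAlgebra.coeff_mul_single_eq_coeff_mul k (by simp), mul_one]
  rw [h3, ← hp, LaurentPolynomial.coeff_toLaurent]
  by_cases hk : ∃ i : ℕ, (i : ℤ) = k + n
  · obtain ⟨i, hi⟩ := hk
    rw [← hi]
    exact (congrArg φ (Finsupp.mapDomain_apply Nat.castEmbedding.injective _ i)).trans (h2 i)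
  · refine (congrArg φ (Finsupp.mapDomain_of_notMem_range _ _ ?_)).trans (map_zero φ)
    rintro ⟨i, hi⟩
    exact hk ⟨i, hi⟩

/-- The value of `v`. -/
noncomputable def vUnit (k : Param) : ℝˣ := (Units.mk0 (k.2 : ℝ) k.ne ^ (k.1 + 1))⁻¹

/-- The value of `z`. -/
noncomputable def zUnit (k : Param) : ℝˣ := Units.mk0 (k.2 - (k.2 : ℝ)⁻¹) (sub_inv_pos' k.2.2).ne'

/-- Evaluation at all parameters at once. -/
noncomputable def evalAll : VZ →+* (Param → ℝ) :=
  RingHom.pi fun k => evalAt (vUnit k) (zUnit k)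

theorem evalAll_apply (f : VZ) (k : Param) : evalAll f k = evalAt (vUnit k) (zUnit k) f := rfl

theorem evalAll_injective : Function.Injective evalAll := by
  rw [injective_iff_map_eq_zero]
  intro f hf
  have h1 : ∀ (s : ℝ) (hs : 0 < s) (k : ℤ), LaurentPolynomial.eval₂ (Int.castRingHom ℝ)
      (Units.mk0 (Real.exp (-s)) (Real.exp_ne_zero _)) (f.coeff k) = 0 := by
    intro s hs
    have hq : ∀ n : ℕ, 1 < Real.exp (s / (n + 1)) := fun n => by
      rw [Real.one_lt_exp_iff]; positivity
    refine laurent_eq_zero _ f (Set.range fun n : ℕ => zUnit (n, ⟨_, hq n⟩)) ?_ ?_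
    · refine Set.infinite_range_of_injective fun n n' h => ?_
      have h2 := congrArg Units.val h
      simp only [zUnit, Units.val_mk0, ← Real.exp_neg] at h2
      have h3 : StrictMono fun x : ℝ => Real.exp x - Real.exp (-x) := fun x y hxy => by
        have := Real.exp_lt_exp.2 hxy
        have := Real.exp_lt_exp.2 (neg_lt_neg hxy)
        simp only; linarith
      have h4 := h3.injective h2
      have h5 : (n : ℝ) + 1 = n' + 1 := by
        have h6 := h4
        field_simp at h6
        linarith
      exact_mod_cast add_right_cancel h5
    · rintro _ ⟨n, rfl⟩
      have h2 := congrFun hf (n, ⟨_, hq n⟩)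
      have h3 : vUnit (n, ⟨_, hq n⟩) = Units.mk0 (Real.exp (-s)) (Real.exp_ne_zero _) := by
        ext
        simp only [vUnit, Units.val_inv_eq_inv_val, Units.val_pow_eq_pow_val, Units.val_mk0,
          ← Real.exp_nat_mul, ← Real.exp_neg]
        congr 1
        push_cast
        field_simp
      rw [← h3]
      exact h2
  refine LaurentPolynomial.ext fun k => LaurentPolynomial.ext fun l => ?_
  have h2 := laurent_eq_zero (Int.castRingHom ℝ) (f.coeff k)
    (Set.range fun n : ℕ => Units.mk0 (Real.exp (-(n + 1 : ℝ))) (Real.exp_ne_zero _)) ?_ ?_ l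
  · simpa using h2
  · refine Set.infinite_range_of_injective fun n n' h => ?_
    have h2 := Real.exp_injective (congrArg Units.val h)
    have h3 := add_right_cancel (neg_injective h2)
    exact_mod_cast h3
  · rintro _ ⟨n, rfl⟩
    exact h1 _ (by positivity) k

/-- The numerical invariants for all parameters. -/
noncomputable def allInv {m : ℕ} (β : Braid m) : Param → ℝ := fun k => numInv k.1 k.ne β

theorem evalAll_vPow_one (k : Param) : evalAll (vPow 1) k = ((k.2 : ℝ) ^ (k.1 + 1))⁻¹ := by
  simp [evalAll_apply, vUnit]

theorem evalAll_vPow_neg_one (k : Param) : evalAll (vPow (-1)) k = (k.2 : ℝ) ^ (k.1 + 1) := by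
  simp [evalAll_apply, vUnit]

theorem evalAll_zPow_one (k : Param) : evalAll (zPow 1) k = (k.2 : ℝ) - (k.2 : ℝ)⁻¹ := by
  simp [evalAll_apply, zUnit]

theorem allInv_skein {m : ℕ} (α β : Braid m) (i : Fin m) :
    evalAll (vPow (-1)) * allInv (α * sigma i * β)
      - evalAll (vPow 1) * allInv (α * (sigma i)⁻¹ * β) = evalAll (zPow 1) * allInv (α * β) := by
  funext k
  simp only [Pi.mul_apply, Pi.sub_apply, evalAll_vPow_one, evalAll_vPow_neg_one, evalAll_zPow_one]
  exact numInv_skein k.1 k.ne α β i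

theorem allInv_conj {m : ℕ} (α β : Braid m) : allInv (α * β * α⁻¹) = allInv β :=
  funext fun k => numInv_conj k.1 k.ne α β

theorem allInv_stab_pos {m : ℕ} (β : Braid m) :
    allInv (addStrand m β * sigma (Fin.last m)) = allInv β :=
  funext fun k => numInv_stab_pos k.1 k.ne β

theorem allInv_stab_neg {m : ℕ} (β : Braid m) :
    allInv (addStrand m β * (sigma (Fin.last m))⁻¹) = allInv β :=
  funext fun k => numInv_stab_neg k.1 k.ne β

/-- In a skein theory with Markov invariance, every value lies in any submodule that contains the
value of the unknot. -/
theorem mem_of_markov {U : Type*} [AddCommGroup U] [Module VZ U] (S : Submodule VZ U)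
    (f : ∀ m, Braid m → U) (hf : ∀ m, IsSkein (f m))
    (conj : ∀ m (α β : Braid m), f m (α * β * α⁻¹) = f m β)
    (pos : ∀ m (β : Braid m), f (m + 1) (addStrand m β * sigma (Fin.last m)) = f m β)
    (neg : ∀ m (β : Braid m), f (m + 1) (addStrand m β * (sigma (Fin.last m))⁻¹) = f m β)
    (one : f 0 1 ∈ S) (m : ℕ) : ∀ β : Braid m, f m β ∈ S := by
  induction m with
  | zero => intro β; rw [braid_zero_eq_one β]; exact one
  | succ m ih =>
    intro β
    refine (Submodule.span_le.2 ?_ : spanSet (f (m + 1)) ≤ S) (mem_spanSet m β _ (hf (m + 1)))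
    rintro _ (⟨a, rfl⟩ | ⟨⟨a, b⟩, rfl⟩)
    · have h := congrArg (zPow (-1) • ·) (hf (m + 1) (addStrand m a) 1 (Fin.last m))
      simp only [mul_one, pos, neg, smul_smul, zPow_mul] at h
      norm_num at h
      simp only [SetLike.mem_coe]
      rw [← h]
      exact S.smul_mem _ (sub_mem (S.smul_mem _ (ih a)) (S.smul_mem _ (ih a)))
    · have e : addStrand m a * sigma (Fin.last m) * addStrand m b =
          (addStrand m b)⁻¹ * (addStrand m (b * a) * sigma (Fin.last m)) *
            ((addStrand m b)⁻¹)⁻¹ := by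
        simp [mul_assoc]
      simp only [SetLike.mem_coe]
      rw [e, conj, pos]
      exact ih _

theorem allInv_mem {m : ℕ} (β : Braid m) : ∃ F : VZ, evalAll F = allInv β := by
  let _ : Module VZ (Param → ℝ) := Module.compHom _ evalAll
  have hs : ∀ (r : VZ) (x : Param → ℝ), r • x = evalAll r * x := fun _ _ => rfl
  have h := mem_of_markov (Submodule.span VZ {(1 : Param → ℝ)}) (fun m β => allInv (m := m) β)
    (fun m α β i => by simpa only [hs] using allInv_skein α β i) (fun m => allInv_conj)
    (fun m => allInv_stab_pos) (fun m => allInv_stab_neg)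
    (by
      have : allInv (1 : Braid 0) = 1 :=
        funext fun k => numInv_one k.1 (zero_lt_one.trans k.2.2)
      rw [this]; exact Submodule.mem_span_singleton_self _) m β
  obtain ⟨F, hF⟩ := Submodule.mem_span_singleton.1 h
  exact ⟨F, by rw [← hF, hs, mul_one]⟩

theorem exists_isHomfly : ∃ P : OrientedLink → VZ, IsHomfly P := by
  choose F hF using fun (b : Σ m, Braid m) => allInv_mem b.2
  have hF' : ∀ {m : ℕ} (β : Braid m), evalAll (F ⟨m, β⟩) = allInv β := fun β => hF ⟨_, β⟩
  refine ⟨Quot.lift F ?_, ?_, ?_⟩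
  · rintro _ _ (⟨m, α, β⟩ | ⟨m, β⟩ | ⟨m, β⟩) <;> apply evalAll_injective
    · rw [hF', hF', allInv_conj]
    · rw [hF', hF', allInv_stab_pos]
    · rw [hF', hF', allInv_stab_neg]
  · apply evalAll_injective
    change evalAll (F ⟨0, 1⟩) = _
    rw [hF', map_one]
    exact funext fun k => numInv_one k.1 (zero_lt_one.trans k.2.2)
  · intro m α β i
    apply evalAll_injective
    change evalAll (_ * F ⟨m, _⟩ - _ * F ⟨m, _⟩) = evalAll (_ * F ⟨m, _⟩)
    rw [map_sub, map_mul, map_mul, map_mul, hF', hF', hF', allInv_skein]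

theorem isHomfly_unique {P Q : OrientedLink → VZ} (hP : IsHomfly P) (hQ : IsHomfly Q) : P = Q := by
  have h : ∀ m (β : Braid m), P (closure β) - Q (closure β) ∈ (⊥ : Submodule VZ VZ) := by
    refine mem_of_markov ⊥ (fun m β => P (closure β) - Q (closure β)) (fun m α β i => ?_)
      (fun m α β => by simp only [closure_conj]) (fun m β => by simp only [closure_stab_pos])
      (fun m β => by simp only [closure_stab_neg]) ?_
    · simp only [smul_eq_mul]
      linear_combination hP.skein m α β i - hQ.skein m α β i
    · have h1 := hP.unknot
      have h2 := hQ.unknot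
      rw [BraidLink.unknot] at h1 h2
      simp [h1, h2]
  funext L
  obtain ⟨m, β⟩ := L
  exact sub_eq_zero.1 ((Submodule.mem_bot VZ).1 (h m β))

end evaluation

/-! ### The HOMFLY polynomial and its coefficient polynomials -/

/-- The HOMFLY polynomial of oriented links: the unique link invariant with value `1` on the unknot
that satisfies the skein relation. -/
noncomputable def homfly : OrientedLink → VZ := exists_isHomfly.choose

theorem homfly_isHomfly : IsHomfly homfly := exists_isHomfly.choose_spec

theorem eq_homfly {P : OrientedLink → VZ} (hP : IsHomfly P) : P = homfly :=
  isHomfly_unique hP homfly_isHomfly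

/-- The `i`-th coefficient polynomial `p^i_L(v)`, where
`P_L(v, z) = (v⁻¹ z) ^ (1 - #L) * ∑ i, p^i_L(v) z ^ (2 i)` and `#L` is the number of components:
the coefficient of `z ^ (2 i)` in `(v⁻¹ z) ^ (#L - 1) * P_L(v, z)`. -/
noncomputable def coeffPoly (i : ℕ) (L : OrientedLink) : ℤ[T;T⁻¹] :=
  ((vPow (-1) * zPow 1) ^ (components L - 1) * homfly L).coeff (2 * (i : ℤ))

/-! ### The knots `K_n` -/

/-- One letter of a braid word: for `1 ≤ k ≤ m` the integer `k` stands for the `k`-th standard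
generator, and `-k` for its inverse. -/
def letter (m : ℕ) (k : ℤ) : Braid m :=
  if h : 1 ≤ k.natAbs ∧ k.natAbs ≤ m then
    sigma ⟨k.natAbs - 1, by omega⟩ ^ k.sign
  else 1

/-- The braid `[k_1, k_2, …]` given by a list of signed indices. -/
def braidWord (m : ℕ) (l : List ℤ) : Braid m := (l.map (letter m)).prod

/-- The list `n - k, n - k + 2, …, n + k`. -/
def xRow (n k : ℕ) : List ℤ := (List.range (k + 1)).map fun j => (n : ℤ) - k + 2 * j

/-- The rows `[n], [n-1, n+1], …, [2, 4, …, 2n-2]`, one after the other. -/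
def xHalf (n : ℕ) : List ℤ := (List.range (n - 1)).flatMap (xRow n)

/-- The word of the braid `X_n`,
`[n, n-1, n+1, …, 1, 3, …, 2n-1, 2n-2, …, 4, 2, …, n+1, n-1, n]`. -/
def xWord (n : ℕ) : List ℤ := xHalf n ++ xRow n (n - 1) ++ (xHalf n).reverse

/-- The list `1, 2, …, n`. -/
def upTo (n : ℕ) : List ℤ := (List.range n).map fun j => (j : ℤ) + 1

/-- The word of the braid `β_n`,
`X_n ^ 3 [-1, -2, …, -(n-1), n, n-1, …, 2, 1, 1, 2, …, n]`. -/
def betaWord (n : ℕ) : List ℤ :=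
  xWord n ++ xWord n ++ xWord n ++ (upTo (n - 1)).map (- ·) ++ (upTo n).reverse ++ upTo n

/-- The knot `K_n`, the closure of the braid `β_n` on `2n` strands (with `2n - 1` standard
generators). -/
def K (n : ℕ) : OrientedLink := closure (braidWord (2 * n - 1) (betaWord n))

end BraidLink

namespace BraidLink

/-! ### The Hecke algebra acting on functions on permutations -/

/-! The proof reads off an extremal coefficient. For a braid `β` with `m` generators and exponent
sum `w`, the HOMFLY polynomial of the closure has degree at most `w + m` in `v`
(Morton–Franks–Williams), and the coefficient of `v ^ (w + m)` is `(-z⁻¹) ^ m * τ(β)`. Here `τ` is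
the canonical trace of the Hecke algebra with `T_k ^ 2 = 1 + z T_k`, that is, the coefficient of
`T_1` in the image of `β`. This is `normHomfly_mem`: after normalization by `v ^ (-(w + m))` both
quantities satisfy the same skein relation `f(L₊) - f(L₋) = z f(L₀)`, and they agree on the
generators of `spanSet`, namely braids that avoid the last generator or use it once.

For `β_n` the exponent sum is `3n² + n + 1` and `m = 2n - 1`, which gives the exponent `3n² + 3n`.
What remains is one Hecke trace. Far commutativity identifies `X_n` with the positive braid in which
two bands of `n` strands cross (`braidWord_xWord`); its permutation `x = wiresPerm n n` is an
involution. Up to conjugation `β_n = X Y X X`, where `Y` is the short word in the letters of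
absolute value at most `n`. The Hecke algebra acts on functionals, `act β g` being `T_w ↦ g(T_w β)`.
The last `X` turns the coefficient functional of `T_1` into that of `T_x`, and the first `X`,
evaluated at `1`, moves the argument to `x`. Only the middle `X` branches, and `Y` changes only the
first `n + 1` positions of `x`.

The branching is controlled by following strands. When two strands with labels `a` (left) and `b`
(right) meet in a positive letter, they pass; if `b < a`, there is also a bounce, with weight `z`. A
strand carried to the right therefore never gains a larger label, and `act_asc_bounce` leaves a
single path. The induction `act_wires_crossed` then shows that the middle `X` gives `z ^ n` times
the coefficient at `T_x` plus `z ^ (n - 1)` times that at one neighbouring permutation, `crossedSwap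
n`. In `Y`, the relation `T_k ^ 2 = 1 + z T_k` opens the positive twist into band generators. All
but the last vanish (`act_band_eq_zero`), and the negative letters give `(-z) ^ (n - 1)`. Hence `τ =
(-z) ^ (n - 1) * (z ^ n + z ^ (n + 2))`, and the extremal coefficient is `(-1) ^ n * (1 + z ^ 2)`.
Since `K_n` is a knot, the term `z ^ 0` is the asserted coefficient. -/

/-- The transposition of `k` and `k + 1`. -/
abbrev adj (k : ℕ) : Equiv.Perm ℕ := Equiv.swap k (k + 1)

theorem adj_of_lt {k l : ℕ} (h : l < k) : adj k l = l :=
  Equiv.swap_apply_of_ne_of_ne (by omega) (by omega)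

theorem adj_of_gt {k l : ℕ} (h : k + 1 < l) : adj k l = l :=
  Equiv.swap_apply_of_ne_of_ne (by omega) (by omega)

theorem adj_comm {k l : ℕ} (h : k + 1 < l) : adj k * adj l = adj l * adj k :=
  (Equiv.Perm.Disjoint.commute (Equiv.Perm.disjoint_swap_swap (by simp; omega))).eq

theorem adj_braid (k : ℕ) : adj k * adj (k + 1) * adj k = adj (k + 1) * adj k * adj (k + 1) := by
  ext x
  simp only [Equiv.Perm.mul_apply, Equiv.swap_apply_def]
  split_ifs <;> omega

section Hecke

variable {R : Type*} [CommRing R] (z : R)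

/-- Right multiplication by the `k`-th generator `T_k` of the Hecke algebra (with
`T_k ^ 2 = 1 + z T_k`), on functionals: `g w` is the value of the functional at `T_w`. -/
def hOp (k : ℕ) : Module.End R (Equiv.Perm ℕ → R) where
  toFun g w := g (w * adj k) + if w (k + 1) < w k then z * g w else 0
  map_add' f g := by
    ext w
    simp only [Pi.add_apply]
    split_ifs <;> ring
  map_smul' a f := by
    ext w
    simp only [Pi.smul_apply, smul_eq_mul, RingHom.id_apply]
    split_ifs <;> ring

theorem hOp_apply (k : ℕ) (g : Equiv.Perm ℕ → R) (w : Equiv.Perm ℕ) :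
    hOp z k g w = g (w * adj k) + if w (k + 1) < w k then z * g w else 0 := rfl

/-- Exactly one of `w` and `w * adj k` has a descent at `k`, so the term linear in `z` occurs once,
and the quadratic one only at a descent of `w`. -/
theorem hOp_sq (k : ℕ) : hOp z k * hOp z k = 1 + z • hOp z k := by
  refine LinearMap.ext fun g => funext fun w => ?_
  have hne : w k ≠ w (k + 1) := fun h => by simpa using w.injective h
  simp only [Module.End.mul_apply, LinearMap.add_apply, Module.End.one_apply, LinearMap.smul_apply,
    Pi.add_apply, Pi.smul_apply, smul_eq_mul, hOp_apply, mul_assoc, Equiv.swap_mul_self, mul_one,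
    Equiv.Perm.mul_apply, Equiv.swap_apply_left, Equiv.swap_apply_right]
  rcases lt_or_gt_of_ne hne with h | h <;> simp [h, h.not_gt]

theorem hOp_comm {k l : ℕ} (h : k + 1 < l) : hOp z k * hOp z l = hOp z l * hOp z k := by
  refine LinearMap.ext fun g => funext fun w => ?_
  simp only [Module.End.mul_apply, hOp_apply, mul_assoc, adj_comm h, Equiv.Perm.mul_apply,
    adj_of_lt (show k < l by omega), adj_of_lt h, adj_of_gt h,
    adj_of_gt (show k + 1 < l + 1 by omega)]
  split_ifs <;> ring

/-- Once the permutations on the two sides are matched by `adj_braid`, only the relative order of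
the labels at `k`, `k + 1`, `k + 2` matters; each of the six orders is a direct check. -/
theorem hOp_braid (k : ℕ) :
    hOp z k * hOp z (k + 1) * hOp z k = hOp z (k + 1) * hOp z k * hOp z (k + 1) := by
  refine LinearMap.ext fun g => funext fun w => ?_
  have h1 : w k ≠ w (k + 1) := fun h => by simpa using w.injective h
  have h2 : w k ≠ w (k + 2) := fun h => by simpa using w.injective h
  have h3 : w (k + 1) ≠ w (k + 2) := fun h => by simpa using w.injective h
  have e := adj_braid k
  simp only [mul_assoc] at e
  simp only [Module.End.mul_apply, hOp_apply, mul_assoc, e, Equiv.Perm.mul_apply,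
    Equiv.swap_apply_left, Equiv.swap_apply_right, adj_of_lt (show k < k + 1 by omega),
    adj_of_gt (show k + 1 < k + 2 by omega), Equiv.swap_mul_self, mul_one, add_assoc,
    Nat.reduceAdd]
  rcases lt_or_gt_of_ne h1 with h1 | h1 <;> rcases lt_or_gt_of_ne h2 with h2 | h2 <;>
    rcases lt_or_gt_of_ne h3 with h3 | h3 <;>
    first
    | (exfalso; omega)
    | (simp [h1, h2, h3, h1.not_gt, h2.not_gt, h3.not_gt]; try ring)

/-- The generators of the Hecke algebra as invertible operators. -/
def hUnit (k : ℕ) : (Module.End R (Equiv.Perm ℕ → R))ˣ where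
  val := hOp z k
  inv := hOp z k - z • 1
  val_inv := by rw [mul_sub, hOp_sq, mul_smul_comm, mul_one, add_sub_cancel_right]
  inv_val := by rw [sub_mul, hOp_sq, smul_mul_assoc, one_mul, add_sub_cancel_right]

/-- The representation of the braid group through the Hecke algebra; strand positions are counted
from `1`. -/
def hecke (m : ℕ) : Braid m →* (Module.End R (Equiv.Perm ℕ → R))ˣ :=
  lift (fun i => hUnit z (i + 1))
    (fun i j h => Units.ext (hOp_comm z (by omega)))
    (fun i j h => Units.ext (by simpa [hUnit, ← h] using hOp_braid z (i + 1)))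

/-- The value of a functional on the product of `T_w` and the image of a braid. -/
def act {m : ℕ} (β : Braid m) (g : Equiv.Perm ℕ → R) : Equiv.Perm ℕ → R := (hecke z m β).val g

theorem act_one {m : ℕ} (g : Equiv.Perm ℕ → R) : act z (1 : Braid m) g = g := by simp [act]

theorem act_mul {m : ℕ} (α β : Braid m) (g : Equiv.Perm ℕ → R) :
    act z (α * β) g = act z α (act z β g) := by simp [act]

theorem act_add {m : ℕ} (β : Braid m) (g h : Equiv.Perm ℕ → R) :
    act z β (g + h) = act z β g + act z β h := by simp [act]

theorem act_sub {m : ℕ} (β : Braid m) (g h : Equiv.Perm ℕ → R) :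
    act z β (g - h) = act z β g - act z β h := by simp [act]

theorem act_smul {m : ℕ} (β : Braid m) (a : R) (g : Equiv.Perm ℕ → R) :
    act z β (a • g) = a • act z β g := by simp [act]

theorem act_sigma {m : ℕ} (i : Fin m) (g : Equiv.Perm ℕ → R) (w : Equiv.Perm ℕ) :
    act z (sigma i) g w =
      g (w * adj (i + 1)) + if w (i + 1 + 1) < w (i + 1) then z * g w else 0 := by
  simp [act, hecke, hUnit, hOp_apply]

theorem act_sigma_inv' {m : ℕ} (i : Fin m) (g : Equiv.Perm ℕ → R) :
    act z (sigma i)⁻¹ g = act z (sigma i) g - z • g := by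
  rw [act, map_inv]
  simp [act, hecke, hUnit]

/-- Since `T_k⁻¹ = T_k - z`, a negative letter bounces at ascents instead of descents, with weight
`-z`. -/
theorem act_sigma_inv {m : ℕ} (i : Fin m) (g : Equiv.Perm ℕ → R) (w : Equiv.Perm ℕ) :
    act z (sigma i)⁻¹ g w =
      g (w * adj (i + 1)) - if w (i + 1) < w (i + 1 + 1) then z * g w else 0 := by
  have hne : w (i + 1) ≠ w (i + 1 + 1) := fun h => by simpa using w.injective h
  rw [act_sigma_inv', Pi.sub_apply, act_sigma, Pi.smul_apply, smul_eq_mul]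
  rcases lt_or_gt_of_ne hne with h | h <;> simp [h, h.not_gt]

/-- Permutations of all of `ℕ` are used so that an added strand leaves the action unchanged: the two
representations agree on generators. -/
theorem act_addStrand {m : ℕ} (β : Braid m) (g : Equiv.Perm ℕ → R) :
    act z (addStrand m β) g = act z β g := by
  have h : (hecke z (m + 1)).comp (addStrand m) = hecke z m :=
    PresentedGroup.ext fun i => by
      change hecke z (m + 1) (addStrand m (sigma i)) = hecke z m (sigma i)
      simp [hecke]
  rw [act, act, ← h]; rfl

theorem act_skein {m : ℕ} (α β : Braid m) (i : Fin m) (g : Equiv.Perm ℕ → R) :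
    act z (α * sigma i * β) g - act z (α * (sigma i)⁻¹ * β) g = z • act z (α * β) g := by
  simp only [act_mul, act_sigma_inv']
  rw [act_sub, act_smul, sub_sub_cancel]

/-! ### The canonical trace -/

open Classical in
/-- The coefficient at `T_u`. -/
noncomputable def delta (R : Type*) [CommRing R] (u : Equiv.Perm ℕ) : Equiv.Perm ℕ → R :=
  fun w => if w = u then 1 else 0

theorem delta_self (u : Equiv.Perm ℕ) : delta R u u = 1 := if_pos rfl

theorem delta_of_ne {u w : Equiv.Perm ℕ} (h : w ≠ u) : delta R u w = 0 := if_neg h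

theorem delta_of_apply_ne {u w : Equiv.Perm ℕ} {p : ℕ} (h : w p ≠ u p) : delta R u w = 0 :=
  delta_of_ne fun e => h (by rw [e])

/-- The canonical trace: the coefficient at `T_1`. -/
noncomputable def tau {m : ℕ} (β : Braid m) : R := act z β (delta R 1) 1

/-- Braids that do not involve the positions of a set preserve functionals supported where these
positions have prescribed values. -/
theorem act_eq_zero {m : ℕ} (β : Braid m) {p : ℕ} (hp : m + 1 < p) (g : Equiv.Perm ℕ → R)
    {a : ℕ} (hg : ∀ w, w p ≠ a → g w = 0) : ∀ w, w p ≠ a → act z β g w = 0 := by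
  induction β using braid_induction generalizing g with
  | one => simpa [act_one] using hg
  | mul β i ih =>
    rw [act_mul]
    refine ih _ fun w hw => ?_
    rw [act_sigma, hg, hg w hw]
    · simp
    · rwa [Equiv.Perm.mul_apply, adj_of_gt (by omega)]
  | inv β i ih =>
    rw [act_mul]
    refine ih _ fun w hw => ?_
    rw [act_sigma_inv, hg, hg w hw]
    · simp
    · rwa [Equiv.Perm.mul_apply, adj_of_gt (by omega)]

theorem tau_one {m : ℕ} : tau z (1 : Braid m) = 1 := by simp [tau, act_one, delta_self]

theorem tau_addStrand {m : ℕ} (β : Braid m) : tau z (addStrand m β) = tau z β := by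
  rw [tau, act_addStrand, tau]

/-- The trace vanishes on braids that involve the last generator exactly once. -/
theorem tau_last {m : ℕ} (a b : Braid m) :
    tau z (addStrand m a * sigma (Fin.last m) * addStrand m b) = 0 := by
  rw [tau, act_mul, act_mul, act_addStrand, act_addStrand]
  have h1 := act_eq_zero z b (p := m + 2) (by omega) (delta R 1) (a := m + 2)
    (fun w hw => delta_of_apply_ne hw)
  set g := act z b (delta R 1)
  -- Vanishing on the permutations that fix `m + 2` and all later positions is preserved, because
  -- `c` moves only positions up to `m + 1`.
  have key : ∀ (c : Braid m) (g : Equiv.Perm ℕ → R),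
      (∀ w, w (m + 2) = m + 2 → (∀ k, m + 2 < k → w k = k) → g w = 0) →
      ∀ w, w (m + 2) = m + 2 → (∀ k, m + 2 < k → w k = k) → act z c g w = 0 := by
    intro c
    induction c using braid_induction with
    | one => simp [act_one]
    | mul c i ih =>
      intro g hg
      rw [act_mul]
      refine ih _ fun w hw hk => ?_
      rw [act_sigma, hg, hg w hw hk]
      · simp
      · rwa [Equiv.Perm.mul_apply, adj_of_gt (by omega)]
      · intro k hk'
        rw [Equiv.Perm.mul_apply, adj_of_gt (by omega), hk k hk']
    | inv c i ih =>
      intro g hg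
      rw [act_mul]
      refine ih _ fun w hw hk => ?_
      rw [act_sigma_inv, hg, hg w hw hk]
      · simp
      · rwa [Equiv.Perm.mul_apply, adj_of_gt (by omega)]
      · intro k hk'
        rw [Equiv.Perm.mul_apply, adj_of_gt (by omega), hk k hk']
  refine key a _ (fun w hw hk => ?_) 1 (by simp) (by simp)
  -- All labels from `m + 2` on are taken by their own positions. Hence the last generator meets an
  -- ascent, so it cannot bounce, and passing removes the label `m + 2` from its place.
  have h2 : w (m + 1) < m + 2 := by
    by_contra! h
    have h3 : w (w (m + 1)) = w (m + 1) := by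
      rcases h.eq_or_lt with h | h
      · rw [← h, hw]
      · exact hk _ h
    have := w.injective h3
    omega
  rw [act_sigma, h1, zero_add, if_neg]
  · simp only [Fin.val_last]
    rw [hw]; omega
  · simp only [Equiv.Perm.mul_apply, Fin.val_last, Equiv.swap_apply_right]
    omega

end Hecke

/-! ### The top coefficient of the HOMFLY polynomial -/

/-- The sum of the exponents of the letters of a braid. -/
def writhe (m : ℕ) : Braid m →* Multiplicative ℤ :=
  lift (fun _ => Multiplicative.ofAdd 1) (fun _ _ _ => rfl) (fun _ _ _ => rfl)

/-- The sum of the exponents of the letters of a braid, as an integer. -/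
def wr {m : ℕ} (β : Braid m) : ℤ := (writhe m β).toAdd

theorem wr_mul {m : ℕ} (α β : Braid m) : wr (α * β) = wr α + wr β := by simp [wr]

theorem wr_inv {m : ℕ} (β : Braid m) : wr β⁻¹ = -wr β := by simp [wr]

theorem wr_one {m : ℕ} : wr (1 : Braid m) = 0 := by simp [wr]

theorem wr_sigma {m : ℕ} (i : Fin m) : wr (sigma i) = 1 := by simp [wr, writhe]

theorem wr_addStrand {m : ℕ} (β : Braid m) : wr (addStrand m β) = wr β := by
  induction β using braid_induction with
  | one => simp [wr_one]
  | mul β i ih => simp [wr_mul, ih, wr_sigma]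
  | inv β i ih => simp [wr_mul, wr_inv, ih, wr_sigma]

/-! ### Coefficients and substitutions for Laurent polynomials -/

theorem coeff_mul_T {S : Type*} [Semiring S] (f : S[T;T⁻¹]) (k j : ℤ) :
    (f * LaurentPolynomial.T k).coeff j = f.coeff (j - k) := by
  rw [LaurentPolynomial.T, AddMonoidAlgebra.coeff_mul_single_eq_coeff_mul (j - k)
    (by intro i _; omega),
    mul_one]

theorem coeff_C_mul {S : Type*} [Semiring S] (a : S) (f : S[T;T⁻¹]) (j : ℤ) :
    (LaurentPolynomial.C a * f).coeff j = a * f.coeff j := by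
  rw [← LaurentPolynomial.smul_eq_C_mul, AddMonoidAlgebra.coeff_smul_apply, smul_eq_mul]

/-- The unit `T 1`. -/
noncomputable def tUnit (S : Type*) [Semiring S] : S[T;T⁻¹]ˣ where
  val := LaurentPolynomial.T 1
  inv := LaurentPolynomial.T (-1)
  val_inv := by rw [← LaurentPolynomial.T_add]; simp
  inv_val := by rw [← LaurentPolynomial.T_add]; simp

theorem tUnit_zpow (S : Type*) [Semiring S] (k : ℤ) :
    ((tUnit S ^ k : S[T;T⁻¹]ˣ) : S[T;T⁻¹]) = LaurentPolynomial.T k := by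
  induction k with
  | zero => simp
  | succ k ih => rw [zpow_add_one, Units.val_mul, ih, LaurentPolynomial.T_add]; rfl
  | pred k ih => rw [zpow_sub_one, Units.val_mul, ih, LaurentPolynomial.T_sub]; rfl

/-- Exchange of the variables `v` and `z`: a polynomial in `v` and `z` as a Laurent polynomial in
`v` whose coefficients are Laurent polynomials in `z`. -/
noncomputable def exch : VZ →+* VZ :=
  LaurentPolynomial.eval₂ (LaurentPolynomial.eval₂ (Int.castRingHom VZ) (tUnit _))
    (Units.map LaurentPolynomial.C.toMonoidHom (tUnit ℤ))

theorem exch_vPow (k : ℤ) : exch (vPow k) = LaurentPolynomial.T k := by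
  rw [exch, vPow, LaurentPolynomial.eval₂_C, LaurentPolynomial.eval₂_T, tUnit_zpow]

theorem exch_zPow (k : ℤ) : exch (zPow k) = LaurentPolynomial.C (LaurentPolynomial.T k) := by
  rw [exch, zPow, LaurentPolynomial.eval₂_T, ← map_zpow, Units.coe_map, tUnit_zpow]; rfl

theorem coeff_exch (f : VZ) (i j : ℤ) : ((exch f).coeff j).coeff i = (f.coeff i).coeff j := by
  induction f using LaurentPolynomial.induction_on' with
  | add p q hp hq => simp [hp, hq]
  | C_mul_T k a =>
    induction a using LaurentPolynomial.induction_on' with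
    | add p q hp hq =>
      rw [map_add, add_mul, map_add]
      simp only [AddMonoidAlgebra.coeff_add, Finsupp.add_apply, hp, hq]
    | C_mul_T l a =>
      have e : (LaurentPolynomial.C (LaurentPolynomial.C a * LaurentPolynomial.T l) *
          LaurentPolynomial.T k : VZ) = (a : VZ) * (vPow l * zPow k) := by
        simp [vPow, zPow, mul_assoc]
      have e2 : exch ((a : VZ) * (vPow l * zPow k)) = LaurentPolynomial.C
          (LaurentPolynomial.C a * LaurentPolynomial.T k) * LaurentPolynomial.T l := by
        rw [map_mul, map_mul, exch_vPow, exch_zPow, map_intCast]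
        simp
        ring
      rw [e, e2, ← e]
      simp only [coeff_C_mul, LaurentPolynomial.T_apply]
      by_cases hl : l = j <;> by_cases hk : k = i <;>
        simp only [hl, hk, coeff_C_mul, LaurentPolynomial.T_apply, if_true, if_false, mul_one,
          mul_zero, AddMonoidAlgebra.coeff_zero, Finsupp.zero_apply]

/-- The value `1` for `v`. -/
noncomputable def forgetV : VZ →+* ℤ[T;T⁻¹] :=
  LaurentPolynomial.eval₂ (LaurentPolynomial.eval₂ (Int.castRingHom _) 1) (tUnit ℤ)

theorem forgetV_vPow (k : ℤ) : forgetV (vPow k) = 1 := by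
  simp [forgetV, vPow, LaurentPolynomial.eval₂_C, LaurentPolynomial.eval₂_T]

theorem forgetV_zPow (k : ℤ) : forgetV (zPow k) = LaurentPolynomial.T k := by
  rw [forgetV, zPow, LaurentPolynomial.eval₂_T, tUnit_zpow]

/-! ### The normalized HOMFLY polynomial and its extremal coefficient -/

/-- The HOMFLY polynomial of a closed braid, as a polynomial in `v` over the polynomials in `z`,
normalized so that its top exponent is at most zero. -/
noncomputable def normHomfly {m : ℕ} (β : Braid m) : VZ :=
  exch (homfly (closure β)) * LaurentPolynomial.T (-(wr β + m))

theorem normHomfly_conj {m : ℕ} (α β : Braid m) :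
    normHomfly (α * β) = normHomfly (β * α) := by
  rw [normHomfly, normHomfly, closure_mul_comm, wr_mul, wr_mul, add_comm (wr α)]

/-- The exponent sums of the three braids differ by one, so the normalization absorbs the factors
`v⁻¹` and `v`. What remains is the Hecke relation `T_k - T_k⁻¹ = z`. -/
theorem normHomfly_skein {m : ℕ} (α β : Braid m) (i : Fin m) :
    normHomfly (α * sigma i * β) - normHomfly (α * (sigma i)⁻¹ * β) =
      LaurentPolynomial.C (LaurentPolynomial.T 1) * normHomfly (α * β) := by
  have h := congrArg (fun x => exch x * LaurentPolynomial.T (-(wr α + wr β + m)))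
    (homfly_isHomfly.skein m α β i)
  simp only [map_sub, map_mul, exch_vPow, exch_zPow] at h
  have e1 : wr (α * sigma i * β) + m = wr α + wr β + m + 1 := by
    rw [wr_mul, wr_mul, wr_sigma]; ring
  have e2 : wr (α * (sigma i)⁻¹ * β) + m = wr α + wr β + m - 1 := by
    rw [wr_mul, wr_mul, wr_inv, wr_sigma]; ring
  rw [normHomfly, normHomfly, normHomfly, e1, e2, wr_mul, ← mul_assoc, ← h, sub_mul, neg_add,
    neg_sub, sub_eq_add_neg 1, LaurentPolynomial.T_add, LaurentPolynomial.T_add 1]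
  generalize exch (homfly _) = x
  generalize exch (homfly _) = y
  ring

/-- A positive stabilization raises `wr + m` by two, while a negative one preserves it; this
asymmetry makes the top coefficient a trace that vanishes on positive stabilizations. -/
theorem normHomfly_stab_pos {m : ℕ} (β : Braid m) :
    normHomfly (addStrand m β * sigma (Fin.last m)) =
      normHomfly β * LaurentPolynomial.T (-2) := by
  rw [normHomfly, normHomfly, closure_stab_pos, LaurentPolynomial.mul_T_assoc, wr_mul, wr_sigma,
    wr_addStrand]
  congr 2; push_cast; ring

theorem normHomfly_stab_neg {m : ℕ} (β : Braid m) :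
    normHomfly (addStrand m β * (sigma (Fin.last m))⁻¹) = normHomfly β := by
  rw [normHomfly, normHomfly, closure_stab_neg, wr_mul, wr_inv, wr_sigma, wr_addStrand]
  congr 2; push_cast; ring

/-- The skein relation at the last generator expresses a free strand as the difference of the two
stabilizations, divided by `z`. -/
theorem normHomfly_addStrand {m : ℕ} (β : Braid m) :
    normHomfly (addStrand m β) = LaurentPolynomial.C (LaurentPolynomial.T (-1)) *
      (normHomfly β * LaurentPolynomial.T (-2) - normHomfly β) := by
  have h := normHomfly_skein (addStrand m β) 1 (Fin.last m)
  rw [mul_one, mul_one, mul_one, normHomfly_stab_pos, normHomfly_stab_neg] at h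
  rw [h, ← mul_assoc, ← map_mul, ← LaurentPolynomial.T_add]
  simp

/-- The Laurent polynomials in `v` with no positive exponents, together with their constant
coefficients. -/
def topCoeffs : Submodule ℤ[T;T⁻¹] (VZ × ℤ[T;T⁻¹]) where
  carrier := {x | (∀ j : ℤ, 0 < j → x.1.coeff j = 0) ∧ x.1.coeff 0 = x.2}
  add_mem' := by
    rintro x y ⟨h1, h2⟩ ⟨h3, h4⟩
    exact ⟨fun j hj => by simp [h1 j hj, h3 j hj], by simp [h2, h4]⟩
  zero_mem' := ⟨fun _ _ => rfl, rfl⟩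
  smul_mem' := by
    rintro a x ⟨h1, h2⟩
    exact ⟨fun j hj => by simp [h1 j hj], by simp [h2]⟩

/-- The Morton–Franks–Williams inequality with its extremal coefficient: the latter is given by
the canonical trace of the Hecke algebra. -/
theorem normHomfly_mem (m : ℕ) : ∀ β : Braid m,
    (normHomfly β, (-LaurentPolynomial.T (-1)) ^ m * tau (LaurentPolynomial.T 1) β)
      ∈ topCoeffs := by
  -- The normalized skein relation contains no power of `v`, so scalars act through `v = 1`. With
  -- this module structure the pair of polynomial and trace is a skein function, and `mem_spanSet`
  -- applies to both components at once.
  let _ : Module VZ (VZ × ℤ[T;T⁻¹]) := Module.compHom _ forgetV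
  have hs : ∀ (r : VZ) (x : VZ × ℤ[T;T⁻¹]), r • x = forgetV r • x := fun _ _ => rfl
  induction m with
  | zero =>
    intro β
    rw [braid_zero_eq_one β]
    have h : normHomfly (1 : Braid 0) = 1 := by
      have := homfly_isHomfly.unknot
      rw [unknot] at this
      simp [normHomfly, this, wr_one]
    rw [h, tau_one]
    refine ⟨fun j hj => ?_, ?_⟩
    · rw [← LaurentPolynomial.T_zero, LaurentPolynomial.T_apply, if_neg hj.ne]
    · rw [← LaurentPolynomial.T_zero, LaurentPolynomial.T_apply]; simp
  | succ m ih =>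
    intro β
    have hf : IsSkein (fun β : Braid (m + 1) => (normHomfly β,
        (-LaurentPolynomial.T (-1)) ^ (m + 1) * tau (LaurentPolynomial.T 1 : ℤ[T;T⁻¹]) β)) := by
      intro α β i
      simp only [hs, forgetV_vPow, forgetV_zPow, one_smul]
      refine Prod.ext ?_ ?_
      · simpa [LaurentPolynomial.smul_eq_C_mul] using normHomfly_skein α β i
      · have h := congrFun (act_skein (LaurentPolynomial.T 1 : ℤ[T;T⁻¹]) α β i
          (delta _ 1)) 1
        simp only [Pi.sub_apply, Pi.smul_apply, smul_eq_mul] at h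
        simp only [Prod.mk_sub_mk, Prod.smul_mk, tau, smul_eq_mul]
        rw [← mul_sub, h]; ring
    have hle : spanSet (fun β : Braid (m + 1) => (normHomfly β,
        (-LaurentPolynomial.T (-1)) ^ (m + 1) * tau (LaurentPolynomial.T 1 : ℤ[T;T⁻¹]) β)) ≤
        ({ topCoeffs with smul_mem' := fun r x hx => topCoeffs.smul_mem (forgetV r) hx } :
          Submodule VZ (VZ × ℤ[T;T⁻¹])) := by
      refine Submodule.span_le.2 ?_
      rintro _ (⟨a, rfl⟩ | ⟨⟨a, b⟩, rfl⟩)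
      -- A free strand multiplies by `z⁻¹ (v⁻² - 1)`. At exponent zero only `-z⁻¹` contributes,
      -- which is the extra factor in front of the unchanged trace.
      · obtain ⟨h1, h2⟩ := ih a
        simp only at h1 h2
        refine ⟨fun j hj => ?_, ?_⟩
        · simp only [normHomfly_addStrand, coeff_C_mul, AddMonoidAlgebra.coeff_sub,
            Finsupp.sub_apply, coeff_mul_T]
          rw [h1 _ hj, h1 _ (by omega)]; simp
        · simp only [normHomfly_addStrand, coeff_C_mul, AddMonoidAlgebra.coeff_sub,
            Finsupp.sub_apply, coeff_mul_T, tau_addStrand]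
          rw [h2, h1 _ (by omega)]; ring
      -- One occurrence of the last generator becomes a positive stabilization after conjugation.
      -- The factor `v⁻²` removes the coefficient at exponent zero, in agreement with `tau_last`.
      · obtain ⟨h1, h2⟩ := ih (b * a)
        simp only at h1 h2
        have e : normHomfly (addStrand m a * sigma (Fin.last m) * addStrand m b) =
            normHomfly (b * a) * LaurentPolynomial.T (-2) := by
          rw [normHomfly_conj, ← mul_assoc, ← map_mul, normHomfly_stab_pos]
        refine ⟨fun j hj => ?_, ?_⟩
        · simp only [e, coeff_mul_T]
          exact h1 _ (by omega)
        · simp only [e, coeff_mul_T, tau_last]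
          rw [h1 _ (by omega), mul_zero]
    exact hle (mem_spanSet m β _ hf)

theorem homfly_coeff {m : ℕ} (β : Braid m) (i : ℤ) :
    ∀ j : ℤ, wr β + m < j → ((homfly (closure β)).coeff i).coeff j = 0 := by
  intro j hj
  have h := (normHomfly_mem m β).1 (j - (wr β + m)) (by omega)
  simp only [normHomfly, coeff_mul_T] at h
  rw [← coeff_exch]
  rw [show j - (wr β + m) - -(wr β + m) = j by ring] at h
  rw [h]; rfl

theorem homfly_top_coeff {m : ℕ} (β : Braid m) (i : ℤ) :
    ((homfly (closure β)).coeff i).coeff (wr β + m) =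
      ((-LaurentPolynomial.T (-1)) ^ m * tau (LaurentPolynomial.T 1) β : ℤ[T;T⁻¹]).coeff i := by
  have h := (normHomfly_mem m β).2
  simp only [normHomfly, coeff_mul_T] at h
  rw [← coeff_exch, ← h]
  rw [zero_sub, neg_neg]

theorem degree_eq_of_coeff {S : Type*} [Semiring S] {f : S[T;T⁻¹]} {d : ℤ}
    (h1 : ∀ j, d < j → f.coeff j = 0) (h2 : f.coeff d ≠ 0) : f.degree = d := by
  refine le_antisymm ?_ (Finset.le_max (Finsupp.mem_support_iff.2 h2))
  refine Finset.max_le fun j hj => ?_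
  by_contra! h
  exact Finsupp.mem_support_iff.1 hj (h1 j (by exact_mod_cast h))

/-! ### The action of braid words -/

theorem braidWord_nil (m : ℕ) : braidWord m [] = 1 := rfl

theorem braidWord_cons (m : ℕ) (k : ℤ) (l : List ℤ) :
    braidWord m (k :: l) = letter m k * braidWord m l := by simp [braidWord]

theorem braidWord_append (m : ℕ) (l l' : List ℤ) :
    braidWord m (l ++ l') = braidWord m l * braidWord m l' := by simp [braidWord]

theorem letter_natCast {m k : ℕ} (h1 : 1 ≤ k) (h2 : k ≤ m) :
    letter m k = sigma ⟨k - 1, by omega⟩ := by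
  have : (k : ℤ).sign = 1 := Int.sign_eq_one_of_pos (by omega)
  simp [letter, h1, h2, this]

theorem letter_neg (m : ℕ) (k : ℤ) : letter m (-k) = (letter m k)⁻¹ := by
  unfold letter
  simp only [Int.natAbs_neg, Int.sign_neg]
  split_ifs <;> simp

/-- The list `p, p + 1, …, p + r - 1`. -/
def asc (p r : ℕ) : List ℤ := (List.range' p r).map (↑)

theorem asc_zero (p : ℕ) : asc p 0 = [] := rfl

theorem asc_succ (p r : ℕ) : asc p (r + 1) = (p : ℤ) :: asc (p + 1) r := by
  simp [asc, List.range'_succ]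

theorem asc_add (p r s : ℕ) : asc p (r + s) = asc p r ++ asc (p + r) s := by
  simp [asc, ← List.map_append]

theorem mem_asc {p r : ℕ} {k : ℤ} : k ∈ asc p r ↔ ∃ j : ℕ, p ≤ j ∧ j < p + r ∧ (j : ℤ) = k := by
  simp [asc, and_assoc]

/-- The cycle that moves `p + r` to `p` and increases `p, …, p + r - 1` by one. -/
def cyc (p : ℕ) : ℕ → Equiv.Perm ℕ
  | 0 => 1
  | r + 1 => adj p * cyc (p + 1) r

theorem cyc_of_lt {p r k : ℕ} (h : k < p) : cyc p r k = k := by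
  induction r generalizing p with
  | zero => rfl
  | succ r ih => rw [cyc, Equiv.Perm.mul_apply, ih (by omega), adj_of_lt h]

theorem cyc_of_gt {p r k : ℕ} (h : p + r < k) : cyc p r k = k := by
  induction r generalizing p with
  | zero => rfl
  | succ r ih => rw [cyc, Equiv.Perm.mul_apply, ih (by omega), adj_of_gt (by omega)]

theorem cyc_mid {p r k : ℕ} (h1 : p ≤ k) (h2 : k < p + r) : cyc p r k = k + 1 := by
  induction r generalizing p with
  | zero => omega
  | succ r ih =>
    rw [cyc, Equiv.Perm.mul_apply]
    rcases h1.eq_or_lt with rfl | h1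
    · rw [cyc_of_lt (by omega), Equiv.swap_apply_left]
    · rw [ih h1 (by omega), adj_of_gt (by omega)]

theorem cyc_last (p r : ℕ) : cyc p r (p + r) = p := by
  induction r generalizing p with
  | zero => rfl
  | succ r ih =>
    rw [cyc, Equiv.Perm.mul_apply, show p + (r + 1) = p + 1 + r by ring, ih,
      Equiv.swap_apply_right]

/-! ### Strands carried through a braid word -/

section act

variable {R : Type*} [CommRing R] (z : R) {m : ℕ}

theorem act_letter {k : ℕ} (h1 : 1 ≤ k) (h2 : k ≤ m) (g : Equiv.Perm ℕ → R)
    (w : Equiv.Perm ℕ) : act z (letter m k) g w =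
      g (w * adj k) + if w (k + 1) < w k then z * g w else 0 := by
  rw [letter_natCast h1 h2, act_sigma]
  simp only [Nat.sub_add_cancel h1]

theorem act_letter_neg {k : ℕ} (h1 : 1 ≤ k) (h2 : k ≤ m) (g : Equiv.Perm ℕ → R)
    (w : Equiv.Perm ℕ) : act z (letter m (-k)) g w =
      g (w * adj k) - if w k < w (k + 1) then z * g w else 0 := by
  rw [letter_neg, letter_natCast h1 h2, act_sigma_inv]
  simp only [Nat.sub_add_cancel h1]

theorem act_zero (β : Braid m) : act z β (0 : Equiv.Perm ℕ → R) = 0 := by simp [act]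

/-- The values of the action of a braid word on a set of permutations that is closed under the
letters are determined by the values of the functional on this set. -/
theorem act_congr {l : List ℤ} (C : Set (Equiv.Perm ℕ))
    (hC : ∀ k ∈ l, ∀ w ∈ C, w * adj k.natAbs ∈ C) {g h : Equiv.Perm ℕ → R}
    (hgh : ∀ w ∈ C, g w = h w) :
    ∀ w ∈ C, act z (braidWord m l) g w = act z (braidWord m l) h w := by
  induction l with
  | nil => simpa [braidWord_nil, act_one] using hgh
  | cons k l ih =>
    intro w hw
    have hw' := hC k (by simp) w hw
    have ih := ih fun k hk => hC k (by simp [hk])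
    simp only [braidWord_cons, act_mul]
    by_cases hk : 1 ≤ k.natAbs ∧ k.natAbs ≤ m
    · rcases Int.natAbs_eq k with e | e
      · rw [e, act_letter z hk.1 hk.2, act_letter z hk.1 hk.2, ih w hw, ih _ hw']
      · rw [e, act_letter_neg z hk.1 hk.2, act_letter_neg z hk.1 hk.2, ih w hw, ih _ hw']
    · simp only [letter, hk, dif_neg, not_false_eq_true, act_one]
      exact ih w hw

/-- Words that do not involve the position `p` preserve the vanishing of a functional for
prescribed values at `p`. -/
theorem act_untouched {l : List ℤ} {p : ℕ} (hl : ∀ k ∈ l, k.natAbs ≠ p ∧ k.natAbs + 1 ≠ p)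
    (S : ℕ → Prop) {g : Equiv.Perm ℕ → R} (hg : ∀ w, S (w p) → g w = 0) (w : Equiv.Perm ℕ)
    (hw : S (w p)) : act z (braidWord m l) g w = 0 := by
  rw [act_congr z {w | S (w p)} (h := 0) ?_ hg w hw, act_zero]
  · rfl
  · intro k hk w hw
    obtain ⟨h1, h2⟩ := hl k hk
    simpa [Equiv.swap_apply_of_ne_of_ne h1.symm h2.symm] using hw

theorem asc_untouched {p r q : ℕ} (h : q < p ∨ p + r < q) :
    ∀ k ∈ asc p r, k.natAbs ≠ q ∧ k.natAbs + 1 ≠ q := by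
  intro k hk
  obtain ⟨j, h1, h2, rfl⟩ := mem_asc.1 hk
  simp only [Int.natAbs_natCast]
  omega

/-- A strand with a small label passes all others. -/
theorem act_asc_of_lt {p r : ℕ} (hp : 1 ≤ p) (hr : p + r ≤ m + 1) (g : Equiv.Perm ℕ → R)
    {w : Equiv.Perm ℕ} (hw : ∀ k, p < k → k ≤ p + r → w p < w k) :
    act z (braidWord m (asc p r)) g w = g (w * cyc p r) := by
  induction r generalizing p w with
  | zero => simp [asc_zero, braidWord_nil, act_one, cyc]
  | succ r ih =>
    have h := hw (p + 1) (by omega) (by omega)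
    rw [asc_succ, braidWord_cons, act_mul, act_letter z hp (by omega), if_neg h.not_gt, add_zero,
      ih (by omega) (by omega), cyc, mul_assoc]
    intro k hk1 hk2
    rw [Equiv.Perm.mul_apply, Equiv.Perm.mul_apply, Equiv.swap_apply_right,
      adj_of_gt (by omega)]
    exact hw k (by omega) (by omega)

/-- The label carried to the right does not increase. -/
theorem act_asc_eq_zero {p r : ℕ} (hp : 1 ≤ p) (hr : p + r ≤ m + 1) {g : Equiv.Perm ℕ → R}
    {a : ℕ} (hg : ∀ w, w (p + r) ≠ a → g w = 0) {w : Equiv.Perm ℕ} (hw : w p < a) :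
    act z (braidWord m (asc p r)) g w = 0 := by
  induction r generalizing p w with
  | zero =>
    rw [asc_zero, braidWord_nil, act_one]
    exact hg _ hw.ne
  | succ r ih =>
    rw [asc_succ, braidWord_cons, act_mul, act_letter z hp (by omega), ih (by omega) (by omega),
      zero_add]
    · split_ifs with h
      · rw [ih (by omega) (by omega), mul_zero]
        · rwa [show p + 1 + r = p + (r + 1) by ring]
        · omega
      · rfl
    · rwa [show p + 1 + r = p + (r + 1) by ring]
    · simpa using hw

/-- If the label `a` has to arrive at the right end, then the strand that starts at the left end
passes all smaller labels and bounces at `a`. -/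
theorem act_asc_bounce {p s t : ℕ} (hp : 1 ≤ p) (hr : p + s + 1 + t ≤ m + 1)
    {g : Equiv.Perm ℕ → R} {a : ℕ} (hg : ∀ w, w (p + s + 1 + t) ≠ a → g w = 0)
    {w : Equiv.Perm ℕ} (h0 : w (p + s + 1) = a)
    (h1 : ∀ k, p < k → k < p + s + 1 → w k < a)
    (h2 : ∀ k, p + s + 1 < k → k ≤ p + s + 1 + t → a < w k) :
    act z (braidWord m (asc p (s + 1 + t))) g w =
      if a < w p then z * g (w * cyc p s * cyc (p + s + 1) t) else 0 := by
  induction s generalizing p w with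
  | zero =>
    simp only [add_zero] at *
    -- If the strand passes `a`, this label stays at position `p`, out of reach of the remaining
    -- letters, and never arrives. Only the bounce survives, and after it `a` is the carried label.
    rw [zero_add, add_comm 1 t, asc_succ, braidWord_cons, act_mul, act_letter z hp (by omega),
      act_untouched z (p := p) (asc_untouched (by omega)) (fun x => x = a), zero_add, h0]
    · split_ifs with h
      · rw [act_asc_of_lt z (by omega) (by omega), cyc, mul_one]
        rw [h0]; exact h2
      · rfl
    · intro w hw
      refine hg w fun h => ?_
      have := w.injective (h.trans hw.symm)
      omega
    · rw [Equiv.Perm.mul_apply, Equiv.swap_apply_left, h0]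
  | succ s ih =>
    have e : p + (s + 1) + 1 = p + 1 + s + 1 := by ring
    rw [show s + 1 + 1 + t = s + 1 + t + 1 by ring, asc_succ, braidWord_cons, act_mul,
      act_letter z hp (by omega)]
    rw [e] at hg h0 h1 h2 ⊢
    rw [ih (by omega) (by omega) hg]
    -- A bounce at a label below `a` would carry that label on; it could never grow back to `a`.
    · rw [Equiv.Perm.mul_apply, Equiv.swap_apply_right, act_asc_eq_zero z (a := a) (by omega)
        (by omega), mul_zero, ite_self, add_zero, cyc]
      · simp only [mul_assoc]
      · rwa [show p + 1 + (s + 1 + t) = p + 1 + s + 1 + t by ring]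
      · exact h1 _ (by omega) (by omega)
    · rwa [Equiv.Perm.mul_apply, adj_of_gt (by omega)]
    · intro k hk1 hk2
      rw [Equiv.Perm.mul_apply, adj_of_gt (by omega)]
      exact h1 k (by omega) hk2
    · intro k hk1 hk2
      rw [Equiv.Perm.mul_apply, adj_of_gt (by omega)]
      exact h2 k hk1 hk2

/-- A bounce that ends in `T_u` would need a descent of `u` at `k`, so `T_u` arises only by passing.
-/
theorem act_letter_delta {k : ℕ} (h1 : 1 ≤ k) (h2 : k ≤ m) {u : Equiv.Perm ℕ}
    (hu : u k < u (k + 1)) : act z (letter m k) (delta R u) = delta R (u * adj k) := by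
  funext w
  rw [act_letter z h1 h2]
  by_cases h : w = u * adj k
  · have e : w * adj k = u := by rw [h, mul_assoc, Equiv.swap_mul_self, mul_one]
    rw [e, h, delta_self, delta_self, delta_of_apply_ne (p := k), mul_zero, ite_self, add_zero]
    simp [hu.ne']
  · rw [delta_of_ne h, delta_of_ne, zero_add]
    · split_ifs with h'
      · rw [delta_of_ne, mul_zero]
        rintro rfl
        omega
      · rfl
    · rintro rfl
      rw [mul_assoc, Equiv.swap_mul_self, mul_one] at h
      exact h rfl

/-- Read backwards from the target `u`: its largest label on this stretch sits at the right end and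
moves left, each letter meeting an ascent. -/
theorem act_asc_delta {p r : ℕ} (hp : 1 ≤ p) (hr : p + r ≤ m + 1) {u : Equiv.Perm ℕ}
    (hu : ∀ k, p ≤ k → k < p + r → u k < u (p + r)) :
    act z (braidWord m (asc p r)) (delta R u) = delta R (u * (cyc p r)⁻¹) := by
  induction r generalizing p with
  | zero => simp [asc_zero, braidWord_nil, act_one, cyc]
  | succ r ih =>
    rw [asc_succ, braidWord_cons, act_mul, ih (by omega) (by omega),
      act_letter_delta z hp (by omega), cyc, mul_inv_rev, Equiv.swap_inv, mul_assoc]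
    · have e1 : (cyc (p + 1) r)⁻¹ p = p := by
        rw [Equiv.Perm.inv_eq_iff_eq, cyc_of_lt (by omega)]
      have e2 : (cyc (p + 1) r)⁻¹ (p + 1) = p + (r + 1) := by
        rw [Equiv.Perm.inv_eq_iff_eq, show p + (r + 1) = p + 1 + r by ring, cyc_last]
      rw [Equiv.Perm.mul_apply, Equiv.Perm.mul_apply, e1, e2]
      exact hu p le_rfl (by omega)
    · intro k hk1 hk2
      rw [show p + 1 + r = p + (r + 1) by ring]
      exact hu k (by omega) (by omega)

/-- The descending word acts on a delta function with a small label at its end. -/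
theorem act_desc_delta {p r : ℕ} (hp : 1 ≤ p) (hr : p + r ≤ m + 1) {u : Equiv.Perm ℕ}
    (hu : ∀ k, p < k → k ≤ p + r → u p < u k) :
    act z (braidWord m (asc p r).reverse) (delta R u) = delta R (u * cyc p r) := by
  induction r generalizing p u with
  | zero => simp [asc_zero, braidWord_nil, act_one, cyc]
  | succ r ih =>
    rw [asc_succ, List.reverse_cons, braidWord_append, act_mul, braidWord_cons, braidWord_nil,
      mul_one, act_letter_delta z hp (by omega) (hu _ (by omega) (by omega)),
      ih (by omega) (by omega), cyc, mul_assoc]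
    intro k hk1 hk2
    rw [Equiv.Perm.mul_apply, Equiv.Perm.mul_apply, Equiv.swap_apply_right,
      adj_of_gt (by omega)]
    exact hu k (by omega) (by omega)

/-- The negative ascending word on an increasing configuration. -/
theorem act_neg_asc {p r : ℕ} (hp : 1 ≤ p) (hr : p + r ≤ m + 1) {g : Equiv.Perm ℕ → R}
    {w : Equiv.Perm ℕ} (hw : ∀ k, p ≤ k → k < p + r → w k < w (k + 1))
    (hg : ∀ k, p ≤ k → k < p + r → ∀ u, u k = w (k + 1) → g u = 0) :
    act z (braidWord m ((asc p r).map (- ·))) g w = (-z) ^ r * g w := by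
  induction r generalizing p with
  | zero => simp [asc_zero, braidWord_nil, act_one]
  | succ r ih =>
    -- Passing would leave the label `w (p + 1)` at position `p`, which later letters do not touch
    -- and where `g` vanishes. Every letter therefore bounces, with factor `-z`.
    rw [asc_succ, List.map_cons, braidWord_cons, act_mul, act_letter_neg z hp (by omega),
      if_pos (hw p le_rfl (by omega)), ih (by omega) (by omega),
      act_untouched z (p := p) _ (fun x => x = w (p + 1)) (hg p le_rfl (by omega))]
    · ring
    · simp
    · intro k hk
      obtain ⟨j, hj, rfl⟩ := List.mem_map.1 hk
      rw [Int.natAbs_neg]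
      exact asc_untouched (by omega) j hj
    · exact fun k h1 h2 => hw k (by omega) (by omega)
    · exact fun k h1 h2 => hg k (by omega) (by omega)

end act

/-! ### The crossing of two bands of `n` strands -/

/-- The braid in which `i` strands cross the `n` strands to their right. -/
def wires (m n : ℕ) : ℕ → Braid m
  | 0 => 1
  | i + 1 => braidWord m (asc (i + 1) n) * wires m n i

/-- The permutation of `wires m n i`. -/
def wiresPerm (n : ℕ) : ℕ → Equiv.Perm ℕ
  | 0 => 1
  | i + 1 => cyc (i + 1) n * wiresPerm n i

theorem wiresPerm_left {n i k : ℕ} (h1 : 1 ≤ k) (h2 : k ≤ n) : wiresPerm n i k = k + i := by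
  induction i with
  | zero => rfl
  | succ i ih => rw [wiresPerm, Equiv.Perm.mul_apply, ih, cyc_mid (by omega) (by omega)]; rfl

theorem wiresPerm_of_gt {n i k : ℕ} (h : n + i < k) : wiresPerm n i k = k := by
  induction i with
  | zero => rfl
  | succ i ih => rw [wiresPerm, Equiv.Perm.mul_apply, ih (by omega), cyc_of_gt (by omega)]

theorem wiresPerm_right {n i k : ℕ} (h1 : n < k) (h2 : k ≤ n + i) :
    wiresPerm n i k = k - n := by
  induction i with
  | zero => omega
  | succ i ih =>
    rw [wiresPerm, Equiv.Perm.mul_apply]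
    rcases h2.eq_or_lt with rfl | h2
    · rw [wiresPerm_of_gt (by omega), show n + (i + 1) = i + 1 + n by ring, cyc_last]; omega
    · rw [ih (by omega), cyc_of_lt (by omega)]

theorem wiresPerm_zero (n i : ℕ) : wiresPerm n i 0 = 0 := by
  induction i with
  | zero => rfl
  | succ i ih => rw [wiresPerm, Equiv.Perm.mul_apply, ih, cyc_of_lt (by omega)]

theorem wiresPerm_mul_self (n : ℕ) : wiresPerm n n * wiresPerm n n = 1 := by
  ext k
  rw [Equiv.Perm.mul_apply, Equiv.Perm.one_apply]
  rcases Nat.eq_zero_or_pos k with rfl | h0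
  · rw [wiresPerm_zero, wiresPerm_zero]
  · rcases le_or_gt k n with h | h
    · rw [wiresPerm_left h0 h, wiresPerm_right (by omega) (by omega)]; omega
    · rcases le_or_gt k (n + n) with h' | h'
      · rw [wiresPerm_right h h', wiresPerm_left (by omega) (by omega)]; omega
      · rw [wiresPerm_of_gt h', wiresPerm_of_gt h']

section act

variable {R : Type*} [CommRing R] (z : R) {m n : ℕ}

/-- All labels of the left band are below those of the right band, so every letter meets an ascent
and nothing branches. -/
theorem act_wires_of_lt {i : ℕ} (hi : i + n ≤ m + 1) (g : Equiv.Perm ℕ → R) {w : Equiv.Perm ℕ}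
    (hw : ∀ j k, 1 ≤ j → j ≤ i → i < k → k ≤ i + n → w j < w k) :
    act z (wires m n i) g w = g (w * wiresPerm n i) := by
  induction i generalizing w with
  | zero => simp [wires, wiresPerm, act_one]
  | succ i ih =>
    rw [wires, act_mul, act_asc_of_lt z (by omega) (by omega), ih (by omega), wiresPerm, mul_assoc]
    · intro j k h1 h2 h3 h4
      rw [Equiv.Perm.mul_apply, Equiv.Perm.mul_apply, cyc_of_lt (by omega),
        cyc_mid (by omega) (by omega)]
      exact hw _ _ h1 (by omega) (by omega) (by omega)
    · exact fun k h1 h2 => hw _ _ (by omega) le_rfl (by omega) h2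

theorem act_wires_delta {i : ℕ} (hi : i + n ≤ m + 1) :
    act z (wires m n i) (delta R 1) = delta R (wiresPerm n i)⁻¹ := by
  induction i with
  | zero => simp [wires, wiresPerm, act_one]
  | succ i ih =>
    rw [wires, act_mul, ih (by omega), act_asc_delta z (by omega) (by omega), wiresPerm,
      mul_inv_rev]
    intro k h1 h2
    have e1 : (wiresPerm n i)⁻¹ (i + 1 + n) = i + 1 + n := by
      rw [Equiv.Perm.inv_eq_iff_eq, wiresPerm_of_gt (by omega)]
    have e2 : (wiresPerm n i)⁻¹ k = k - i := by
      rw [Equiv.Perm.inv_eq_iff_eq, wiresPerm_left (by omega) (by omega)]; omega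
    rw [e1, e2]
    omega

theorem act_wires_eq_zero {i p a : ℕ} (hp : i + n < p) {g : Equiv.Perm ℕ → R}
    (hg : ∀ w, w p ≠ a → g w = 0) : ∀ w, w p ≠ a → act z (wires m n i) g w = 0 := by
  induction i with
  | zero => simpa [wires, act_one] using hg
  | succ i ih =>
    intro w hw
    rw [wires, act_mul]
    exact act_untouched z (asc_untouched (by omega)) (· ≠ a) (ih (by omega)) w hw

open Classical in
/-- The main count: the paths through the crossing of two bands that end at the crossed
configuration, from a configuration in which all but one of the small labels are at their final
level. -/
theorem act_wires_crossed {i : ℕ} (h1 : 1 ≤ i) (hin : i ≤ n) (hm : n + n ≤ m + 1)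
    (w : Equiv.Perm ℕ) (hw0 : w 0 = 0) (hw1 : ∀ k, i + n < k → w k = wiresPerm n n k)
    (hw2 : ∀ k, 2 ≤ k → k ≤ i → w (i + k) = k) (hw3 : ∃ k, k ≤ i + 1 ∧ w k = 1) :
    act z (wires m n i) (delta R (wiresPerm n n)) w =
      (if w (i + 1) = 1 ∧ (∀ k, 1 ≤ k → k ≤ i → w k = n + k) ∧
          (∀ k, i + i < k → k ≤ i + n → w k = n + (k - i)) then z ^ i else 0) +
      (if w 1 = 1 ∧ w (i + 1) = n + 1 ∧ (∀ k, 2 ≤ k → k ≤ i → w k = n + k) ∧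
          (∀ k, i + i < k → k ≤ i + n → w k = n + (k - i)) then z ^ (i - 1) else 0) := by
  have hinj : ∀ {w : Equiv.Perm ℕ} {j k : ℕ}, j ≠ k → w j ≠ w k := fun h e =>
    h (Equiv.injective _ e)
  induction i, h1 using Nat.le_induction generalizing w with
  | base =>
    -- Once the label `1` has reached position `n + 1`, only the first `n` positions can distinguish
    -- `u` from the crossed configuration.
    have hx : ∀ u : Equiv.Perm ℕ, u 0 = 0 → (∀ k, 1 + n < k → u k = wiresPerm n n k) →
        u (n + 1) = 1 → (u = wiresPerm n n ↔ ∀ k, 1 ≤ k → k ≤ n → u k = n + k) := by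
      intro u h0 h1 h2
      constructor
      · rintro rfl k hk1 hk2
        rw [wiresPerm_left hk1 hk2, add_comm]
      · intro h
        ext k
        rcases Nat.eq_zero_or_pos k with rfl | hk
        · rw [h0, wiresPerm_zero]
        · rcases le_or_gt k n with hk' | hk'
          · rw [h k hk hk', wiresPerm_left hk hk', add_comm]
          · rcases eq_or_ne k (n + 1) with rfl | hk2
            · rw [h2, wiresPerm_right (by omega) (by omega)]; omega
            · rw [h1 k (by omega)]
    obtain ⟨n, rfl⟩ : ∃ n', n = n' + 1 := ⟨n - 1, by omega⟩
    rw [wires, wires, mul_one]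
    obtain ⟨k, hk, hk1⟩ := hw3
    have hk0 : k ≠ 0 := by rintro rfl; omega
    have hg : ∀ u : Equiv.Perm ℕ, u (1 + (n + 1)) ≠ 1 →
        delta R (wiresPerm (n + 1) (n + 1)) u = 0 := by
      intro u hu
      refine delta_of_apply_ne (p := 1 + (n + 1)) ?_
      rw [wiresPerm_right (by omega) (by omega)]
      omega
    -- The label `1` must arrive at the right end. From position `2` it is picked up by a bounce
    -- (the summand with `z`); from position `1` it is itself carried past everything (the summand
    -- with `z ^ 0`).
    obtain rfl | rfl : k = 2 ∨ k = 1 := by omega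
    · have h11 : w 1 ≠ 1 := hk1 ▸ hinj (by omega)
      have h10 : w 1 ≠ 0 := hw0 ▸ hinj (by omega)
      have h := act_asc_bounce z (m := m) (p := 1) (s := 0) (t := n) (w := w) (a := 1)
        (g := delta R (wiresPerm (n + 1) (n + 1))) le_rfl (by omega)
        (fun u hu => hg u (by rwa [add_comm n 1, ← add_assoc])) hk1 (by omega) (by
          intro k hk _
          have : w k ≠ 1 := hk1 ▸ hinj (by omega)
          have : w k ≠ 0 := hw0 ▸ hinj (by omega)
          omega)
      rw [zero_add, add_comm 1 n, if_pos (by omega)] at h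
      rw [h, if_neg (c := w 1 = 1 ∧ _) (fun h => h11 h.1), add_zero, delta, pow_one, mul_ite, mul_one, mul_zero]
      refine if_congr ?_ rfl rfl
      have c1 : ∀ k, 1 < k → k < n + 2 → (w * cyc 1 0 * cyc (1 + 0 + 1) n) k = w (k + 1) :=
        fun k h1 h2 => by simp [cyc, cyc_mid (show 2 ≤ k by omega) (show k < 2 + n by omega)]
      have c2 : (w * cyc 1 0 * cyc (1 + 0 + 1) n) 1 = w 1 := by simp [cyc, cyc_of_lt]
      rw [hx]
      · refine ⟨fun h => ⟨hk1, fun k hk hk' => ?_, fun k hk hk' => ?_⟩, fun h k hk hk' => ?_⟩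
        · obtain rfl : k = 1 := by omega
          rw [← c2, h 1 le_rfl (by omega)]
        · have := h (k - 1) (by omega) (by omega)
          rwa [c1 _ (by omega) (by omega), Nat.sub_add_cancel (by omega)] at this
        · rcases hk.eq_or_lt with rfl | hk
          · rw [c2]; exact h.2.1 1 le_rfl le_rfl
          · rw [c1 k hk (by omega), h.2.2 (k + 1) (by omega) (by omega)]; rfl
      · simp [cyc, cyc_of_lt, hw0]
      · intro k hk
        rw [← hw1 k (by omega)]
        simp [cyc, cyc_of_gt (show 2 + n < k by omega)]
      · simp only [cyc, mul_one, Equiv.Perm.mul_apply]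
        rw [show n + 1 + 1 = 2 + n by ring, cyc_last, hk1]
    · have h21 : w 2 ≠ 1 := hk1 ▸ hinj (by omega)
      rw [act_asc_of_lt z le_rfl (by omega), if_neg (fun h => h21 h.1), zero_add, delta, pow_zero]
      · refine if_congr ?_ rfl rfl
        have c1 : ∀ k, 1 ≤ k → k < n + 2 → (w * cyc 1 (n + 1)) k = w (k + 1) :=
          fun k h1 h2 => by simp [cyc_mid h1 (show k < 1 + (n + 1) by omega)]
        rw [hx]
        · refine ⟨fun h => ⟨hk1, ?_, by omega, fun k hk hk' => ?_⟩, fun h k hk hk' => ?_⟩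
          · rw [← c1 1 le_rfl (by omega), h 1 le_rfl (by omega)]
          · have := h (k - 1) (by omega) (by omega)
            rwa [c1 _ (by omega) (by omega), Nat.sub_add_cancel (by omega)] at this
          · rw [c1 k hk (by omega)]
            rcases hk.eq_or_lt with rfl | hk
            · exact h.2.1
            · rw [h.2.2.2 (k + 1) (by omega) (by omega)]; rfl
        · simp [cyc_of_lt, hw0]
        · intro k hk
          rw [← hw1 k (by omega)]
          simp [cyc_of_gt (show 1 + (n + 1) < k by omega)]
        · rw [Equiv.Perm.mul_apply, add_comm (n + 1) 1, cyc_last, hk1]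
      · intro k hk _
        have : w k ≠ 1 := hk1 ▸ hinj (by omega)
        have : w k ≠ 0 := hw0 ▸ hinj (by omega)
        omega
  | succ i hi ih =>
    obtain ⟨t, rfl⟩ : ∃ t, n = i + 1 + t := ⟨n - (i + 1), by omega⟩
    set n := i + 1 + t with hn
    obtain ⟨k₁, hk₁, hk1⟩ := hw3
    have hk0 : k₁ ≠ 0 := by rintro rfl; omega
    -- The labels `2, …, i + 1` occupy the positions `i + 3, …, 2 i + 2`, and the label `1` is at
    -- `k₁`.
    have hbig : ∀ k, k ≠ 0 → k ≠ k₁ → (k ≤ i + 2 ∨ i + 1 + (i + 1) < k) → i + 1 < w k := by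
      intro k h0 h1 h2
      by_contra! h
      rcases Nat.lt_or_ge (w k) 2 with h3 | h3
      · have : w k ≠ 1 := hk1 ▸ hinj h1
        have : w k ≠ 0 := hw0 ▸ hinj h0
        omega
      · have := w.injective (hw2 (w k) h3 h)
        omega
    set g := act z (wires m n i) (delta R (wiresPerm n n)) with hgdef
    -- The remaining `i` wires do not reach position `i + 1 + n`, so its final label `i + 1` must
    -- arrive with the current wire.
    have hg : ∀ u : Equiv.Perm ℕ, u (i + 1 + n) ≠ i + 1 → g u = 0 := by
      refine act_wires_eq_zero z (by omega) fun u hu => delta_of_apply_ne (p := i + 1 + n) ?_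
      rw [wiresPerm_right (by omega) (by omega)]
      omega
    -- The forced path after the first letter: the carried strand passes the labels `2, …, i` and
    -- bounces at `i + 1`, which then passes the `t` larger labels to its right.
    set c := cyc (i + 2) (i - 1) * cyc (i + 1 + (i + 1)) t with hc
    have c1 : ∀ k, k < i + 2 → c k = k := fun k hk => by
      rw [hc, Equiv.Perm.mul_apply, cyc_of_lt (show k < i + 1 + (i + 1) by omega), cyc_of_lt hk]
    have c2 : ∀ k, i + 2 ≤ k → k ≤ i + i → c k = k + 1 := fun k h1 h2 => by
      rw [hc, Equiv.Perm.mul_apply, cyc_of_lt (show k < i + 1 + (i + 1) by omega),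
        cyc_mid h1 (by omega)]
    have c3 : c (i + 1 + i) = i + 2 := by
      rw [hc, Equiv.Perm.mul_apply, cyc_of_lt (show i + 1 + i < i + 1 + (i + 1) by omega),
        show i + 1 + i = i + 2 + (i - 1) by omega, cyc_last]
    have c4 : ∀ k, i + 1 + (i + 1) ≤ k → k < i + 1 + n → c k = k + 1 := fun k h1 h2 => by
      rw [hc, Equiv.Perm.mul_apply, cyc_mid h1 (by omega), cyc_of_gt (by omega)]
    have c5 : c (i + 1 + n) = i + 1 + (i + 1) := by
      rw [hc, Equiv.Perm.mul_apply, show i + 1 + n = i + 1 + (i + 1) + t by omega, cyc_last,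
        cyc_of_gt (by omega)]
    have c6 : ∀ k, i + 1 + n < k → c k = k := fun k hk => by
      rw [hc, Equiv.Perm.mul_apply, cyc_of_gt (show i + 1 + (i + 1) + t < k by omega),
        cyc_of_gt (by omega)]
    have hF : ∀ u : Equiv.Perm ℕ, (∀ k, i + 2 < k → u k = w k) →
        act z (braidWord m (asc (i + 2) (i + t))) g u =
          if i + 1 < u (i + 2) then z * g (u * c) else 0 := by
      intro u hu
      have e : i + 2 + (i - 1) + 1 = i + 1 + (i + 1) := by omega
      have h := act_asc_bounce z (m := m) (p := i + 2) (s := i - 1) (t := t) (w := u) (a := i + 1)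
        (g := g) (by omega) (by omega)
        (fun v hv => hg v (by rwa [e, show i + 1 + (i + 1) + t = i + 1 + n by omega] at hv))
        (by rw [e, hu _ (by omega)]; exact hw2 _ (by omega) le_rfl)
        (by
          intro k h1 h2
          rw [hu k h1]
          have := hw2 (k - (i + 1)) (by omega) (by omega)
          rw [show i + 1 + (k - (i + 1)) = k by omega] at this
          omega)
        (by
          intro k h1 h2
          rw [hu k (by omega)]
          exact hbig k (by omega) (by omega) (by omega))
      rwa [e, show i - 1 + 1 + t = i + t by omega, mul_assoc u] at h
    -- The forced path leads again to a configuration of the required shape, now for `i` wires.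
    have hclass : ∀ u : Equiv.Perm ℕ, (∀ k, i + 2 < k → u k = w k) → u 0 = 0 →
        (∃ k, k ≤ i + 1 ∧ u k = 1) →
        (u * c) 0 = 0 ∧ (∀ k, i + n < k → (u * c) k = wiresPerm n n k) ∧
        (∀ k, 2 ≤ k → k ≤ i → (u * c) (i + k) = k) ∧ ∃ k, k ≤ i + 1 ∧ (u * c) k = 1 := by
      intro u hu hu0 hu3
      refine ⟨?_, fun k hk => ?_, fun k h1 h2 => ?_, ?_⟩
      · rw [Equiv.Perm.mul_apply, c1 0 (by omega), hu0]
      · rw [Equiv.Perm.mul_apply]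
        rcases eq_or_ne k (i + 1 + n) with rfl | hk'
        · rw [c5, hu _ (by omega), hw2 _ (by omega) le_rfl, wiresPerm_right (by omega) (by omega)]
          omega
        · rw [c6 k (by omega), hu k (by omega), hw1 k (by omega)]
      · rw [Equiv.Perm.mul_apply, c2 _ (by omega) (by omega), hu _ (by omega),
          show i + k + 1 = i + 1 + k by ring, hw2 _ h1 (by omega)]
      · obtain ⟨k, hk, hk'⟩ := hu3
        exact ⟨k, hk, by rw [Equiv.Perm.mul_apply, c1 k (by omega), hk']⟩
    rw [wires, act_mul, show asc (i + 1) n = ((i + 1 : ℕ) : ℤ) :: asc (i + 2) (i + t) by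
      rw [hn, show i + 1 + t = i + t + 1 by ring, asc_succ], braidWord_cons, act_mul,
      act_letter z (by omega) (by omega), ← hgdef,
      hF _ fun k hk => by rw [Equiv.Perm.mul_apply, adj_of_gt (by omega)], hF w fun _ _ => rfl]
    rw [Equiv.Perm.mul_apply, Equiv.swap_apply_right]
    -- A bounce at the first letter leaves `w (i + 1)` in place with `i + 1 < w (i + 2) < w (i +
    -- 1)`. The first summand of the induction hypothesis would need `w (i + 1) = 1`. The second
    -- would need `w (i + 1) = n + 1`, but then the label `w (i + 2) ≤ n` already sits beyond
    -- position `i + 1 + n`.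
    have hsecond : (if w (i + 1 + 1) < w (i + 1) then
        z * (if i + 1 < w (i + 2) then z * g (w * c) else 0) else 0) = 0 := by
      split_ifs with h1 h2
      · have hk : k₁ ≠ i + 2 := by rintro rfl; omega
        obtain ⟨a1, a2, a3, a4⟩ := hclass w (fun _ _ => rfl) hw0 ⟨k₁, by omega, hk1⟩
        have e1 : (w * c) (i + 1) = w (i + 1) := by rw [Equiv.Perm.mul_apply, c1 _ (by omega)]
        have e2 : w (i + 1 + 1) = w (i + 2) := rfl
        rw [ih (by omega) _ a1 a2 a3 a4, if_neg, if_neg, add_zero, mul_zero, mul_zero]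
        · rintro ⟨-, h3, -⟩
          rw [e1] at h3
          have h4 : w (i + 2) = w (n + w (i + 2)) := by
            rw [hw1 (n + w (i + 2)) (by omega), wiresPerm_right (by omega) (by omega)]; omega
          have := w.injective h4
          omega
        · rintro ⟨h3, -⟩
          omega
      · rw [mul_zero]
      · rfl
    rw [hsecond, add_zero]
    have hd0 : (w * adj (i + 1)) 0 = 0 := by rw [Equiv.Perm.mul_apply, adj_of_lt (by omega), hw0]
    set u := w * adj (i + 1) with hu
    have u1 : ∀ k, k < i + 1 → (u * c) k = w k := fun k hk => by
      rw [hu, Equiv.Perm.mul_apply, Equiv.Perm.mul_apply, c1 k (by omega), adj_of_lt hk]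
    have u2 : (u * c) (i + 1) = w (i + 1 + 1) := by
      rw [hu, Equiv.Perm.mul_apply, Equiv.Perm.mul_apply, c1 _ (by omega), Equiv.swap_apply_left]
    have u3 : (u * c) (i + 1 + i) = w (i + 1) := by
      rw [hu, Equiv.Perm.mul_apply, Equiv.Perm.mul_apply, c3, Equiv.swap_apply_right]
    have u4 : ∀ k, i + 1 + (i + 1) ≤ k → k < i + 1 + n → (u * c) k = w (k + 1) := fun k h h' => by
      rw [hu, Equiv.Perm.mul_apply, Equiv.Perm.mul_apply, c4 k h h', adj_of_gt (by omega)]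
    -- After passing at the first letter, the carried label is `w (i + 1)`; it can bounce at `i + 1`
    -- only if it is larger. Otherwise both sides vanish, since each summand prescribes `w (i + 1) =
    -- n + (i + 1)`.
    by_cases h1 : i + 1 < w (i + 1)
    · obtain ⟨a1, a2, a3, a4⟩ := hclass u
        (fun k hk => by rw [hu, Equiv.Perm.mul_apply, adj_of_gt (by omega)]) hd0 (by
          have : k₁ ≠ i + 1 := by rintro rfl; omega
          rcases eq_or_ne k₁ (i + 2) with rfl | h
          · exact ⟨i + 1, le_rfl, by rw [hu, Equiv.Perm.mul_apply, Equiv.swap_apply_left, hk1]⟩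
          · exact ⟨k₁, by omega, by
              rw [hu, Equiv.Perm.mul_apply, adj_of_lt (by omega), hk1]⟩)
      -- The bounced label `w (i + 1)` now stands at position `2 i + 1`, so the condition on it
      -- moves from the left range to the right range. The values `a = 1` and `a = 2` serve the two
      -- summands.
      have hlow : ∀ a, a ≤ i + 1 → (((∀ k, a ≤ k → k ≤ i → (u * c) k = n + k) ∧
          (∀ k, i + i < k → k ≤ i + n → (u * c) k = n + (k - i))) ↔
          ((∀ k, a ≤ k → k ≤ i + 1 → w k = n + k) ∧
          (∀ k, i + 1 + (i + 1) < k → k ≤ i + 1 + n → w k = n + (k - (i + 1))))) := by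
        intro a ha
        constructor
        · rintro ⟨b1, b2⟩
          refine ⟨fun k hk hk' => ?_, fun k hk hk' => ?_⟩
          · rcases hk'.eq_or_lt with rfl | hk'
            · rw [← u3, b2 _ (by omega) (by omega)]; omega
            · rw [← u1 k hk', b1 k hk (by omega)]
          · have := b2 (k - 1) (by omega) (by omega)
            rw [u4 _ (by omega) (by omega), Nat.sub_add_cancel (by omega)] at this
            omega
        · rintro ⟨b1, b2⟩
          refine ⟨fun k hk hk' => ?_, fun k hk hk' => ?_⟩
          · rw [u1 k (by omega), b1 k hk (by omega)]
          · rcases Nat.lt_or_ge k (i + 1 + (i + 1)) with h | h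
            · obtain rfl : k = i + 1 + i := by omega
              rw [u3, b1 _ ha le_rfl]; omega
            · rw [u4 k h (by omega), b2 _ (by omega) (by omega)]; omega
      rw [if_pos h1, ih (by omega) _ a1 a2 a3 a4, mul_add, mul_ite, mul_ite, mul_zero,
        ← pow_succ', ← pow_succ', Nat.sub_add_cancel hi, Nat.add_sub_cancel, u1 1 (by omega), u2]
      exact congrArg₂ (· + ·)
        (if_congr (and_congr_right' (hlow 1 (by omega))) rfl rfl)
        (if_congr (and_congr_right' (and_congr_right' (hlow 2 (by omega)))) rfl rfl)
    · rw [if_neg h1, if_neg, if_neg, add_zero]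
      · rintro ⟨-, -, h, -⟩
        have := h (i + 1) (by omega) le_rfl
        omega
      · rintro ⟨-, h, -⟩
        have := h (i + 1) (by omega) le_rfl
        omega

end act

/-! ### Identities between braid words -/

section words

variable {m : ℕ}

theorem letter_comm {j k : ℕ} (h : j + 1 < k) : Commute (letter m j) (letter m k) := by
  by_cases hj : 1 ≤ j ∧ j ≤ m
  · by_cases hk : 1 ≤ k ∧ k ≤ m
    · rw [letter_natCast hj.1 hj.2, letter_natCast hk.1 hk.2]
      exact sigma_comm _ _ (by simp only; omega)
    · have : letter m k = 1 := dif_neg (by simpa using hk)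
      rw [this]; exact Commute.one_right _
  · have : letter m j = 1 := dif_neg (by simpa using hj)
    rw [this]; exact Commute.one_left _

theorem letter_braid {k : ℕ} (h1 : 1 ≤ k) (h2 : k + 1 ≤ m) :
    letter m k * letter m (k + 1 : ℕ) * letter m k =
      letter m (k + 1 : ℕ) * letter m k * letter m (k + 1 : ℕ) := by
  rw [letter_natCast h1 (by omega), letter_natCast (by omega) h2]
  exact sigma_braid _ _ (by simp only; omega)

theorem braidWord_comm {l : List ℤ} {j : ℕ}
    (h : ∀ k ∈ l, k.natAbs + 1 < j ∨ j + 1 < k.natAbs) :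
    Commute (letter m j) (braidWord m l) := by
  induction l with
  | nil => exact Commute.one_right _
  | cons k l ih =>
    rw [braidWord_cons]
    refine Commute.mul_right ?_ (ih fun k hk => h k (by simp [hk]))
    have h2 : Commute (letter m j) (letter m k.natAbs) := by
      rcases h k (by simp) with h | h
      · exact (letter_comm h).symm
      · exact letter_comm h
    rcases Int.natAbs_eq k with e | e
    · rwa [e]
    · rw [e, letter_neg]; exact h2.inv_right

theorem natAbs_of_mem_asc {p r : ℕ} {k : ℤ} (h : k ∈ asc p r) :
    p ≤ k.natAbs ∧ k.natAbs < p + r := by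
  obtain ⟨j, h1, h2, rfl⟩ := mem_asc.1 h
  simp [h1, h2]

/-- The two forms of the band generator of the strands `k` and `k + r + 1`. -/
theorem band_eq {k r : ℕ} (h1 : 1 ≤ k) (h2 : k + r ≤ m) :
    braidWord m (asc (k + 1) r).reverse * letter m k * braidWord m (asc (k + 1) r) =
      braidWord m (asc k r) * letter m (k + r : ℕ) * braidWord m (asc k r).reverse := by
  induction r generalizing k with
  | zero => simp [asc_zero, braidWord_nil]
  | succ r ih =>
    have ih := ih (k := k + 1) (by omega) (by omega)
    have hc : Commute (letter m k) (braidWord m (asc (k + 1 + 1) r)) := by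
      refine braidWord_comm fun j hj => ?_
      have := natAbs_of_mem_asc hj
      omega
    have hc' : Commute (letter m k) (braidWord m (asc (k + 1 + 1) r).reverse) := by
      refine braidWord_comm fun j hj => ?_
      have := natAbs_of_mem_asc (List.mem_reverse.1 hj)
      omega
    rw [asc_succ, asc_succ, List.reverse_cons, List.reverse_cons, braidWord_append,
      braidWord_append, braidWord_cons, braidWord_cons, braidWord_cons, braidWord_cons,
      braidWord_nil, mul_one, mul_one, show k + (r + 1) = k + 1 + r by ring]
    calc _ = braidWord m (asc (k + 1 + 1) r).reverse * (letter m (k + 1 : ℕ) * letter m k *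
          letter m (k + 1 : ℕ)) * braidWord m (asc (k + 1 + 1) r) := by simp only [mul_assoc]
      _ = (braidWord m (asc (k + 1 + 1) r).reverse * letter m k) * letter m (k + 1 : ℕ) *
          (letter m k * braidWord m (asc (k + 1 + 1) r)) := by
          rw [← letter_braid h1 (by omega)]; simp only [mul_assoc]
      _ = letter m k * (braidWord m (asc (k + 1 + 1) r).reverse * letter m (k + 1 : ℕ) *
          braidWord m (asc (k + 1 + 1) r)) * letter m k := by
          rw [← hc'.eq, hc.eq]; simp only [mul_assoc]
      _ = _ := by rw [ih]; simp only [mul_assoc]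

/-- Conjugation by the negative ascending word shifts the generators. -/
theorem neg_asc_mul_letter {r i : ℕ} (h1 : 1 ≤ i) (h2 : i + 1 ≤ r) (h3 : r ≤ m) :
    braidWord m ((asc 1 r).map (- ·)) * letter m i =
      letter m (i + 1 : ℕ) * braidWord m ((asc 1 r).map (- ·)) := by
  obtain ⟨s, rfl⟩ : ∃ s, r = (i - 1) + (s + 1 + 1) := ⟨r - (i + 1), by omega⟩
  have hc : Commute (letter m i) (braidWord m ((asc (i + 1 + 1) s).map (- ·))) := by
    refine braidWord_comm fun j hj => ?_
    obtain ⟨k, hk, rfl⟩ := List.mem_map.1 hj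
    have := natAbs_of_mem_asc hk
    omega
  have hc' : Commute (letter m (i + 1 : ℕ)) (braidWord m ((asc 1 (i - 1)).map (- ·))) := by
    refine braidWord_comm fun j hj => ?_
    obtain ⟨k, hk, rfl⟩ := List.mem_map.1 hj
    have := natAbs_of_mem_asc hk
    omega
  have hb : (letter m i)⁻¹ * (letter m (i + 1 : ℕ))⁻¹ * letter m i =
      letter m (i + 1 : ℕ) * (letter m i)⁻¹ * (letter m (i + 1 : ℕ))⁻¹ := by
    have := letter_braid h1 (show i + 1 ≤ m by omega)
    generalize letter m i = a at *
    generalize letter m (i + 1 : ℕ) = b at *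
    rw [eq_mul_inv_iff_mul_eq, mul_assoc, mul_assoc, inv_mul_eq_iff_eq_mul, inv_mul_eq_iff_eq_mul]
    calc a * b = a * b * a * a⁻¹ := by group
      _ = _ := by rw [this]; group
  rw [asc_add, show 1 + (i - 1) = i by omega, asc_succ, asc_succ, List.map_append, List.map_cons,
    List.map_cons, braidWord_append, braidWord_cons, braidWord_cons, letter_neg, letter_neg]
  calc _ = braidWord m ((asc 1 (i - 1)).map (- ·)) * (letter m i)⁻¹ * (letter m (i + 1 : ℕ))⁻¹ *
        (braidWord m ((asc (i + 1 + 1) s).map (- ·)) * letter m i) := by simp only [mul_assoc]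
    _ = braidWord m ((asc 1 (i - 1)).map (- ·)) * ((letter m i)⁻¹ * (letter m (i + 1 : ℕ))⁻¹ *
        letter m i) * braidWord m ((asc (i + 1 + 1) s).map (- ·)) := by
        rw [← hc.eq]; simp only [mul_assoc]
    _ = (braidWord m ((asc 1 (i - 1)).map (- ·)) * letter m (i + 1 : ℕ)) * (letter m i)⁻¹ *
        (letter m (i + 1 : ℕ))⁻¹ * braidWord m ((asc (i + 1 + 1) s).map (- ·)) := by
        rw [hb]; simp only [mul_assoc]
    _ = _ := by rw [← hc'.eq]; simp only [mul_assoc]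

theorem neg_asc_mul_asc {r k s : ℕ} (h1 : 1 ≤ k) (h2 : k + s ≤ r) (h3 : r ≤ m) :
    braidWord m ((asc 1 r).map (- ·)) * braidWord m (asc k s) =
      braidWord m (asc (k + 1) s) * braidWord m ((asc 1 r).map (- ·)) := by
  induction s generalizing k with
  | zero => simp [asc_zero, braidWord_nil]
  | succ s ih =>
    rw [asc_succ, asc_succ, braidWord_cons, braidWord_cons, ← mul_assoc,
      neg_asc_mul_letter h1 (by omega) h3, mul_assoc, ih (by omega) (by omega), mul_assoc]

/-- All positive letters but the last are shifted across the negative word; the last one cancels the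
final negative letter. -/
theorem neg_asc_mul_asc_last {k s : ℕ} (h1 : 1 ≤ k) (h3 : k + s ≤ m) :
    braidWord m ((asc 1 (k + s)).map (- ·)) * braidWord m (asc k (s + 1)) =
      braidWord m (asc (k + 1) s) * braidWord m ((asc 1 (k + s - 1)).map (- ·)) := by
  have e : asc 1 (k + s) = asc 1 (k + s - 1) ++ asc (k + s) 1 := by
    conv_lhs => rw [show k + s = k + s - 1 + 1 by omega, asc_add]
    rw [show 1 + (k + s - 1) = k + s by omega]
  rw [asc_add k s 1, braidWord_append, ← mul_assoc, neg_asc_mul_asc h1 le_rfl h3, e, List.map_append,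
    braidWord_append, asc_succ, asc_zero, List.map_cons, braidWord_cons, braidWord_cons, letter_neg]
  simp [braidWord_nil, mul_assoc]

end words

/-! ### The trace of the braid of the knot -/

section trace

variable {R : Type*} [CommRing R] (z : R) {m n : ℕ}

/-- The configurations that differ from the crossed one in the first `n + 1` positions only. -/
def nearCrossed (n : ℕ) : Set (Equiv.Perm ℕ) :=
  {w | w 0 = 0 ∧ (∀ k, n + 1 < k → w k = wiresPerm n n k) ∧ ∃ k, k ≤ n + 1 ∧ w k = 1}

theorem nearCrossed_mul_adj {w : Equiv.Perm ℕ} (hw : w ∈ nearCrossed n) {k : ℕ} (h1 : 1 ≤ k)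
    (h2 : k ≤ n) : w * adj k ∈ nearCrossed n := by
  obtain ⟨a, b, c, hc, hc'⟩ := hw
  refine ⟨?_, fun j hj => ?_, adj k c, ?_, ?_⟩
  · rw [Equiv.Perm.mul_apply, adj_of_lt (by omega), a]
  · rw [Equiv.Perm.mul_apply, adj_of_gt (by omega), b j hj]
  · rw [Equiv.swap_apply_def]; split_ifs <;> omega
  · rw [Equiv.Perm.mul_apply, Equiv.swap_apply_self, hc']

/-- The crossed configuration with its smallest labels on both sides exchanged. -/
def crossedSwap (n : ℕ) : Equiv.Perm ℕ := wiresPerm n n * Equiv.swap 1 (n + 1)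

theorem crossedSwap_one (hn : 1 ≤ n) : crossedSwap n 1 = 1 := by
  rw [crossedSwap, Equiv.Perm.mul_apply, Equiv.swap_apply_left,
    wiresPerm_right (by omega) (by omega)]
  omega

theorem crossedSwap_succ (hn : 1 ≤ n) : crossedSwap n (n + 1) = n + 1 := by
  rw [crossedSwap, Equiv.Perm.mul_apply, Equiv.swap_apply_right,
    wiresPerm_left (by omega) (by omega)]
  omega

theorem crossedSwap_of_ne {k : ℕ} (h1 : k ≠ 1) (h2 : k ≠ n + 1) :
    crossedSwap n k = wiresPerm n n k := by
  rw [crossedSwap, Equiv.Perm.mul_apply, Equiv.swap_apply_of_ne_of_ne h1 h2]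

/-- The explicit form of the coefficients of the crossed configuration. -/
noncomputable def bandCoeff (n : ℕ) : Equiv.Perm ℕ → R :=
  z ^ n • delta R (wiresPerm n n) + z ^ (n - 1) • delta R (crossedSwap n)

/-- This is `act_wires_crossed` for `i = n`: the right range is empty, and each of the two
conditions determines `w` completely. -/
theorem act_wires_nearCrossed (hn : 1 ≤ n) (hm : n + n ≤ m + 1) {w : Equiv.Perm ℕ}
    (hw : w ∈ nearCrossed n) :
    act z (wires m n n) (delta R (wiresPerm n n)) w = bandCoeff z n w := by
  classical
  obtain ⟨h0, h1, h2⟩ := hw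
  rw [act_wires_crossed z hn le_rfl hm w h0 (fun k hk => h1 k (by omega)) ?_ h2]
  · simp only [bandCoeff, Pi.add_apply, Pi.smul_apply, smul_eq_mul, delta, mul_ite, mul_one,
      mul_zero]
    refine congrArg₂ (· + ·) ?_ ?_
    all_goals refine if_congr (Iff.intro ?_ ?_) rfl rfl
    · rintro ⟨a, b, -⟩
      ext k
      rcases Nat.eq_zero_or_pos k with rfl | hk
      · rw [h0, wiresPerm_zero]
      · rcases lt_trichotomy k (n + 1) with h | rfl | h
        · rw [b k hk (by omega), wiresPerm_left hk (by omega), add_comm]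
        · rw [a, wiresPerm_right (by omega) (by omega)]; omega
        · exact h1 k h
    · rintro rfl
      refine ⟨?_, fun k hk hk' => ?_, fun k hk hk' => by omega⟩
      · rw [wiresPerm_right (by omega) (by omega)]; omega
      · rw [wiresPerm_left hk hk', add_comm]
    · rintro ⟨a, b, c, -⟩
      ext k
      rcases Nat.eq_zero_or_pos k with rfl | hk
      · rw [h0, crossedSwap_of_ne (by omega) (by omega), wiresPerm_zero]
      · rcases eq_or_ne k 1 with rfl | hk1
        · rw [a, crossedSwap_one hn]
        · rcases lt_trichotomy k (n + 1) with h | rfl | h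
          · rw [c k (by omega) (by omega), crossedSwap_of_ne hk1 h.ne,
              wiresPerm_left hk (by omega), add_comm]
          · rw [b, crossedSwap_succ hn]
          · rw [h1 k h, crossedSwap_of_ne hk1 h.ne']
    · rintro rfl
      refine ⟨crossedSwap_one hn, crossedSwap_succ hn, fun k hk hk' => ?_,
        fun k hk hk' => by omega⟩
      rw [crossedSwap_of_ne (by omega) (by omega), wiresPerm_left (by omega) hk', add_comm]
  · intro k hk hk'
    rw [h1 _ (by omega), wiresPerm_right (by omega) (by omega)]
    omega

theorem act_square {k : ℕ} (h1 : 1 ≤ k) (h2 : k ≤ m) (α β : Braid m) (g : Equiv.Perm ℕ → R) :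
    act z (α * letter m k * letter m k * β) g =
      act z (α * β) g + z • act z (α * letter m k * β) g := by
  rw [letter_natCast h1 h2, ← act_skein, mul_inv_cancel_right, add_sub_cancel]

/-- The band generators other than the last one do not contribute. -/
theorem act_band_eq_zero {k r : ℕ} (h1 : 1 ≤ k) (hn : k + (r + 1) = n) (hm : n ≤ m) :
    act z (braidWord m ((asc 1 (n - 1)).map (- ·)) * (braidWord m (asc (k + 1) (r + 1)).reverse *
      letter m k * braidWord m (asc (k + 1) (r + 1)))) (bandCoeff z n) (wiresPerm n n) = 0 := by
  have x1 : ∀ j, 1 ≤ j → j ≤ n → wiresPerm n n j = n + j := fun j h h' => by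
    rw [wiresPerm_left h h', add_comm]
  have x2 : wiresPerm n n (n + 1) = 1 := by
    rw [wiresPerm_right (by omega) (by omega)]; omega
  have y1 : crossedSwap n 1 = 1 := crossedSwap_one (by omega)
  have y2 : ∀ j, 2 ≤ j → j ≤ n → crossedSwap n j = n + j := fun j h h' => by
    rw [crossedSwap_of_ne (by omega) (by omega), x1 j (by omega) h']
  have y3 : crossedSwap n (n + 1) = n + 1 := crossedSwap_succ (by omega)
  have hF : act z (braidWord m (asc k (r + 1)).reverse) (bandCoeff z n) =
      z ^ n • delta R (wiresPerm n n * cyc k (r + 1)) +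
        z ^ (n - 1) • delta R (crossedSwap n * cyc k (r + 1)) := by
    rw [bandCoeff, act_add, act_smul, act_smul, act_desc_delta z h1 (by omega),
      act_desc_delta z h1 (by omega)]
    · intro j hj hj'
      rw [y2 j (by omega) (by omega)]
      rcases eq_or_ne k 1 with rfl | hk
      · rw [y1]; omega
      · rw [y2 k (by omega) (by omega)]; omega
    · intro j hj hj'
      rw [x1 k h1 (by omega), x1 j (by omega) (by omega)]; omega
  have c1 : cyc k (r + 1) n = k := by rw [← hn, cyc_last]
  have c2 : cyc k (r + 1) (n + 1) = n + 1 := cyc_of_gt (by omega)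
  -- The two delta functions in `hF` expect the labels `n + k` and `1` at positions `n`, `n + 1`, or
  -- the label `n + 1` at `n + 1`. The pair `n + k + 1`, `1` reaches neither, whether it passes or
  -- bounces.
  have hH : ∀ w ∈ {w : Equiv.Perm ℕ | w n = n + k + 1 ∧ w (n + 1) = 1},
      act z (letter m n) (act z (braidWord m (asc k (r + 1)).reverse) (bandCoeff z n)) w =
        (0 : Equiv.Perm ℕ → R) w := by
    rintro w ⟨a, b⟩
    rw [act_letter z (by omega) hm, hF]
    simp only [Pi.add_apply, Pi.smul_apply, smul_eq_mul, Pi.zero_apply]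
    rw [delta_of_apply_ne (w := w * adj n) (p := n), delta_of_apply_ne (w := w * adj n) (p := n + 1),
      delta_of_apply_ne (w := w) (p := n), delta_of_apply_ne (w := w) (p := n + 1)]
    · simp
    · rw [b, Equiv.Perm.mul_apply, c2, y3]; omega
    · rw [a, Equiv.Perm.mul_apply, c1, x1 k h1 (by omega)]; omega
    · rw [Equiv.Perm.mul_apply, Equiv.swap_apply_right, a, Equiv.Perm.mul_apply, c2, y3]; omega
    · rw [Equiv.Perm.mul_apply, Equiv.swap_apply_left, b, Equiv.Perm.mul_apply, c1,
        x1 k h1 (by omega)]; omega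
  have e : n - 1 = k + r := by omega
  -- The second form of the band lets one positive letter cancel. The remaining ascending word
  -- brings `n + k + 1` to position `n`, and the shortened negative word no longer touches `n` or `n
  -- + 1`.
  rw [band_eq h1 (by omega), ← mul_assoc, ← mul_assoc, e, neg_asc_mul_asc_last h1 (by omega),
    show k + (r + 1) = n from hn]
  rw [act_mul, act_mul, act_mul, act_asc_of_lt z (by omega) (by omega)]
  · refine (act_congr z _ ?_ hH _ ⟨?_, ?_⟩).trans (by rw [act_zero, Pi.zero_apply])
    · rintro j hj w ⟨a, b⟩
      obtain ⟨i, hi, rfl⟩ := List.mem_map.1 hj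
      have := natAbs_of_mem_asc hi
      rw [Int.natAbs_neg]
      constructor
      · rw [Equiv.Perm.mul_apply, adj_of_gt (by omega), a]
      · rw [Equiv.Perm.mul_apply, adj_of_gt (by omega), b]
    · rw [Equiv.Perm.mul_apply, show n = k + 1 + r by omega, cyc_last, ← show n = k + 1 + r by omega,
        x1 _ (by omega) (by omega)]; omega
    · rw [Equiv.Perm.mul_apply, cyc_of_gt (by omega), x2]
  · intro j hj hj'
    rw [x1 _ (by omega) (by omega), x1 _ (by omega) (by omega)]; omega

/-- The innermost square `T_k ^ 2 = 1 + z T_k` either disappears, leaving the same word for `k + 1`,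
or leaves a band generator, which contributes nothing. The value is thus independent of `k` and is
computed at `k = n`. -/
theorem act_twist (hn : 2 ≤ n) (hm : n ≤ m) {k r : ℕ} (h1 : 1 ≤ k) (h2 : k + r = n) :
    act z (braidWord m ((asc 1 (n - 1)).map (- ·)) * (braidWord m (asc k (r + 1)).reverse *
      braidWord m (asc k (r + 1)))) (bandCoeff z n) (wiresPerm n n) =
      (-z) ^ (n - 1) * (z ^ n + z ^ (n + 2)) := by
  have x1 : ∀ j, 1 ≤ j → j ≤ n → wiresPerm n n j = n + j := fun j h h' => by
    rw [wiresPerm_left h h', add_comm]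
  have x2 : wiresPerm n n (n + 1) = 1 := by
    rw [wiresPerm_right (by omega) (by omega)]; omega
  have y1 : crossedSwap n 1 = 1 := crossedSwap_one (by omega)
  have y2 : ∀ j, 2 ≤ j → j ≤ n → crossedSwap n j = n + j := fun j h h' => by
    rw [crossedSwap_of_ne (by omega) (by omega), x1 j (by omega) h']
  induction r generalizing k with
  | zero =>
    obtain rfl : k = n := by omega
    -- This is the vanishing that `act_neg_asc` needs: a passing in the negative word puts the label
    -- `k + j + 1` at position `j`.
    have hG : ∀ u : Equiv.Perm ℕ, ∀ j, 1 ≤ j → j < k → u j = k + (j + 1) →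
        bandCoeff z k u = 0 := by
      intro u j hj hj' hu
      simp only [bandCoeff, Pi.add_apply, Pi.smul_apply, smul_eq_mul]
      rw [delta_of_apply_ne (p := j), delta_of_apply_ne (p := j)]
      · simp
      · rcases eq_or_ne j 1 with rfl | h
        · rw [y1]; omega
        · rw [y2 j (by omega) (by omega)]; omega
      · rw [x1 j hj hj'.le]; omega
    have hG1 : bandCoeff z k (wiresPerm k k) = z ^ k := by
      simp only [bandCoeff, Pi.add_apply, Pi.smul_apply, smul_eq_mul]
      rw [delta_self, delta_of_apply_ne (p := 1)]
      · simp
      · rw [y1, x1 1 le_rfl h1]; omega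
    have hG2 : bandCoeff z k (wiresPerm k k * adj k) = 0 := by
      simp only [bandCoeff, Pi.add_apply, Pi.smul_apply, smul_eq_mul]
      rw [delta_of_apply_ne (p := k), delta_of_apply_ne (p := k)]
      · simp
      · rw [Equiv.Perm.mul_apply, Equiv.swap_apply_left, x2, y2 k hn le_rfl]; omega
      · rw [Equiv.Perm.mul_apply, Equiv.swap_apply_left, x2, x1 k h1 le_rfl]; omega
    have hinc : ∀ j, 1 ≤ j → j < 1 + (k - 1) → wiresPerm k k j < wiresPerm k k (j + 1) := by
      intro j hj hj'
      rw [x1 j hj (by omega), x1 (j + 1) (by omega) (by omega)]; omega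
    -- The identity term gives `z ^ k`. In the other term the letter `k` can only bounce at the
    -- descent of the crossed configuration, which gives `z * z * z ^ k`.
    have h := congrFun (act_square z h1 hm (braidWord m ((asc 1 (k - 1)).map (- ·))) 1
      (bandCoeff z k)) (wiresPerm k k)
    simp only [mul_one, Pi.add_apply, Pi.smul_apply, smul_eq_mul] at h
    simp only [asc_succ, asc_zero, List.reverse_singleton, braidWord_cons, braidWord_nil, mul_one]
    rw [← mul_assoc, h, act_mul, act_neg_asc z le_rfl (by omega) hinc,
      act_neg_asc z le_rfl (by omega) hinc, hG1, act_letter z h1 hm, hG1, hG2, if_pos]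
    · ring
    · rw [x2, x1 k h1 le_rfl]; omega
    · intro j hj hj' u hu
      rw [x1 (j + 1) (by omega) (by omega)] at hu
      rw [act_letter z h1 hm, hG u j hj (by omega) hu, hG _ j hj (by omega)]
      · simp
      · rw [Equiv.Perm.mul_apply, adj_of_lt (by omega), hu]
    · intro j hj hj' u hu
      rw [x1 (j + 1) (by omega) (by omega)] at hu
      exact hG u j hj (by omega) hu
  | succ r ih =>
    have h := congrFun (act_square z h1 (show k ≤ m by omega)
      (braidWord m ((asc 1 (n - 1)).map (- ·)) * braidWord m (asc (k + 1) (r + 1)).reverse)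
      (braidWord m (asc (k + 1) (r + 1))) (bandCoeff z n)) (wiresPerm n n)
    have h0 := act_band_eq_zero z h1 h2 hm
    simp only [Pi.add_apply, Pi.smul_apply, smul_eq_mul, mul_assoc] at h h0
    rw [h0, mul_zero, add_zero] at h
    rw [← ih (k := k + 1) (by omega) (by omega), ← h, asc_succ k (r + 1), List.reverse_cons,
      braidWord_append, braidWord_cons, braidWord_cons]
    simp only [braidWord_nil, mul_one, mul_assoc]

/-- The canonical trace of the braid of the knot. -/
theorem tau_bands (hn : 2 ≤ n) (hm : n + n ≤ m + 1) :
    tau z (wires m n n * (braidWord m ((asc 1 (n - 1)).map (- ·)) *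
      (braidWord m (asc 1 n).reverse * braidWord m (asc 1 n))) * wires m n n * wires m n n) =
      (-z) ^ (n - 1) * (z ^ n + z ^ (n + 2)) := by
  have hx : (wiresPerm n n)⁻¹ = wiresPerm n n := inv_eq_of_mul_eq_one_right (wiresPerm_mul_self n)
  obtain ⟨r, hr⟩ : ∃ r, n = r + 1 := ⟨n - 1, by omega⟩
  rw [tau, act_mul, act_mul, act_mul, act_wires_delta z hm, hx, act_wires_of_lt z hm, one_mul,
    ← act_twist z hn (show n ≤ m by omega) (k := 1) (r := r) le_rfl (by omega), ← hr]
  · simp only [← braidWord_append]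
    -- The letters of the twist have absolute value at most `n`, so from the crossed configuration
    -- they never leave `nearCrossed n`, where the middle crossing is known explicitly.
    refine act_congr z (nearCrossed n) ?_ (fun w hw => act_wires_nearCrossed z (by omega) hm hw) _
      ⟨wiresPerm_zero n n, fun _ _ => rfl, n + 1, le_rfl, ?_⟩
    · intro k hk w hw
      refine nearCrossed_mul_adj hw ?_ ?_ <;>
      · rcases List.mem_append.1 hk with hk | hk
        · obtain ⟨i, hi, rfl⟩ := List.mem_map.1 hk
          have := natAbs_of_mem_asc hi
          rw [Int.natAbs_neg]; omega
        · have hk : k ∈ asc 1 n := by simpa using hk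
          have := natAbs_of_mem_asc hk
          omega
    · rw [wiresPerm_right (by omega) (by omega)]; omega
  · intro j k _ h2 h3 _
    simp only [Equiv.Perm.one_apply]; omega

end trace

/-! ### The word of the crossing of two bands -/

section rows

variable (m n : ℕ)

/-- The crossing at time `t` on the wire that starts at position `i`. -/
def crossingAt (t i : ℕ) : Braid m :=
  if n ≤ t + i ∧ t + i < 2 * n then letter m (2 * i + t - n : ℕ) else 1

/-- The crossings at time `t` on the first `j` wires. -/
def crossingRow (t : ℕ) : ℕ → Braid m
  | 0 => 1
  | j + 1 => crossingAt m n t (j + 1) * crossingRow t j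

/-- The crossings before time `t` on the first `j` wires, row by row. -/
def crossingRows (j : ℕ) : ℕ → Braid m
  | 0 => 1
  | t + 1 => crossingRows j t * crossingRow m n t j

/-- The crossings before time `t` on the wire that starts at position `i`. -/
def crossingWire (i : ℕ) : ℕ → Braid m
  | 0 => 1
  | t + 1 => crossingWire i t * crossingAt m n t i

theorem crossingAt_comm {t t' i i' : ℕ} (ht : t' < t) (hi : i' < i) :
    Commute (crossingAt m n t i) (crossingAt m n t' i') := by
  unfold crossingAt
  split_ifs
  · exact (letter_comm (by omega)).symm
  all_goals simp

theorem crossingRow_comm {t t' i j : ℕ} (ht : t' < t) (hj : j < i) :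
    Commute (crossingAt m n t i) (crossingRow m n t' j) := by
  induction j with
  | zero => exact Commute.one_right _
  | succ j ih => exact (crossingAt_comm m n ht hj).mul_right (ih (by omega))

theorem crossingRows_comm {t t' i j : ℕ} (ht : t' ≤ t) (hj : j < i) :
    Commute (crossingAt m n t i) (crossingRows m n j t') := by
  induction t' with
  | zero => exact Commute.one_right _
  | succ t' ih => exact (ih (by omega)).mul_right (crossingRow_comm m n ht hj)

/-- A crossing on the new wire commutes with all earlier crossings on wires to its left, since the
indices differ by at least three. The whole wire can thus be pulled to the front, turning row order
into wire order. -/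
theorem crossingRows_succ (j t : ℕ) :
    crossingRows m n (j + 1) t = crossingWire m n (j + 1) t * crossingRows m n j t := by
  induction t with
  | zero => simp [crossingRows, crossingWire]
  | succ t ih =>
    have hc := (crossingRows_comm m n (t := t) le_rfl (Nat.lt_succ_self j)).eq
    simp only [Nat.succ_eq_add_one] at hc
    rw [crossingRows, crossingRow, ih, crossingWire, crossingRows, mul_assoc, mul_assoc,
      ← mul_assoc (crossingRows m n j t), ← hc]
    simp only [mul_assoc]

/-- Wire `i` is idle until time `n - i`, then meets one letter per unit of time, from `i` to `i + n
- 1`; the minimum records both bounds. -/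
theorem crossingWire_eq {i : ℕ} (hi : i ≤ n) (t : ℕ) :
    crossingWire m n i t = braidWord m (asc i (min (t + i - n) n)) := by
  induction t with
  | zero => rw [show min (0 + i - n) n = 0 by omega]; rfl
  | succ t ih =>
    rw [crossingWire, ih, crossingAt]
    split_ifs with h
    · rw [show min (t + 1 + i - n) n = min (t + i - n) n + 1 by omega, asc_add, braidWord_append,
        asc_succ, asc_zero, braidWord_cons, braidWord_nil, mul_one,
        show 2 * i + t - n = i + min (t + i - n) n by omega]
    · rw [show min (t + 1 + i - n) n = min (t + i - n) n by omega, mul_one]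

theorem crossingRows_zero (t : ℕ) : crossingRows m n 0 t = 1 := by
  induction t with
  | zero => rfl
  | succ t ih => rw [crossingRows, ih, crossingRow, one_mul]

theorem crossingRows_eq_wires {j : ℕ} (hj : j ≤ n) :
    crossingRows m n j (2 * n - 1) = wires m n j := by
  induction j with
  | zero => rw [crossingRows_zero, wires]
  | succ j ih =>
    rw [crossingRows_succ, crossingWire_eq m n hj, ih (by omega), wires,
      show min (2 * n - 1 + (j + 1) - n) n = n by omega]

/-! ### The rows of the word of `X_n` -/

/-- The list `p, p + 2, …, p + 2 (l - 1)`. -/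
def oddRow (p l : ℕ) : List ℤ := (List.range l).map fun j : ℕ => (p : ℤ) + 2 * j

theorem oddRow_succ (p l : ℕ) : oddRow p (l + 1) = oddRow p l ++ [((p + 2 * l : ℕ) : ℤ)] := by
  simp [oddRow, List.range_succ]

theorem braidWord_oddRow_reverse (p l : ℕ) :
    braidWord m (oddRow p l).reverse = braidWord m (oddRow p l) := by
  induction l with
  | zero => rfl
  | succ l ih =>
    rw [oddRow_succ, List.reverse_append, braidWord_append, braidWord_append, ih,
      List.reverse_singleton, braidWord_cons, braidWord_nil, mul_one]
    refine (braidWord_comm fun k hk => ?_).eq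
    obtain ⟨j, hj, rfl⟩ := List.mem_map.1 hk
    have := List.mem_range.1 hj
    omega

theorem crossingRow_low {t j : ℕ} (ht : t < n) (hj : j ≤ n) :
    crossingRow m n t j = braidWord m (oddRow (n - t) (j + t + 1 - n)).reverse := by
  induction j with
  | zero => rw [show 0 + t + 1 - n = 0 by omega]; rfl
  | succ j ih =>
    rw [crossingRow, ih (by omega), crossingAt]
    split_ifs with h
    · rw [show j + 1 + t + 1 - n = j + t + 1 - n + 1 by omega, oddRow_succ, List.reverse_append,
        braidWord_append, List.reverse_singleton, braidWord_cons, braidWord_nil, mul_one,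
        show 2 * (j + 1) + t - n = n - t + 2 * (j + t + 1 - n) by omega]
    · rw [show j + 1 + t + 1 - n = j + t + 1 - n by omega, one_mul]

theorem crossingRow_high {s j : ℕ} (hj : j ≤ n) :
    crossingRow m n (n + s) j = braidWord m (oddRow (s + 2) (min j (n - 1 - s))).reverse := by
  induction j with
  | zero => rw [show min 0 (n - 1 - s) = 0 by omega]; rfl
  | succ j ih =>
    rw [crossingRow, ih (by omega), crossingAt]
    split_ifs with h
    · rw [show min (j + 1) (n - 1 - s) = min j (n - 1 - s) + 1 by omega, oddRow_succ,
        List.reverse_append, braidWord_append, List.reverse_singleton, braidWord_cons,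
        braidWord_nil, mul_one, show 2 * (j + 1) + (n + s) - n = s + 2 + 2 * min j (n - 1 - s) by
          omega]
    · rw [show min (j + 1) (n - 1 - s) = min j (n - 1 - s) by omega, one_mul]

theorem xRow_eq {k : ℕ} (hk : k < n) : xRow n k = oddRow (n - k) (k + 1) := by
  simp only [xRow, oddRow, Nat.cast_sub hk.le, List.pure_def, List.bind_eq_flatMap,
    ← List.map_eq_flatMap, List.map_map, Function.comp_def]

theorem crossingRows_low {t : ℕ} (ht : t ≤ n) :
    crossingRows m n n t = braidWord m ((List.range t).flatMap (xRow n)) := by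
  induction t with
  | zero => rfl
  | succ t ih =>
    rw [crossingRows, ih (by omega), crossingRow_low m n ht le_rfl, List.range_succ,
      List.flatMap_append, braidWord_append, braidWord_oddRow_reverse, List.flatMap_singleton,
      xRow_eq n ht, show n + t + 1 - n = t + 1 by omega]

/-- Induction from the last time backwards: the row at time `n + s` is the first row of the reversed
remaining word. -/
theorem crossingRows_high {s : ℕ} (hs : s + 1 ≤ n) :
    crossingRows m n n (n + s) * braidWord m ((List.range (n - 1 - s)).flatMap (xRow n)).reverse =
      crossingRows m n n (2 * n - 1) := by
  obtain ⟨r, hr⟩ : ∃ r, n = s + 1 + r := ⟨n - (s + 1), by omega⟩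
  induction r generalizing s with
  | zero =>
    rw [show n - 1 - s = 0 by omega, show 2 * n - 1 = n + s by omega]
    simp [braidWord_nil]
  | succ r ih =>
    rw [← ih (s := s + 1) (by omega) (by omega), show n - 1 - s = n - 1 - (s + 1) + 1 by omega,
      List.range_succ, List.flatMap_append, List.flatMap_singleton, List.reverse_append,
      braidWord_append, ← mul_assoc, ← add_assoc n s 1, crossingRows,
      crossingRow_high m n le_rfl, xRow_eq n (by omega),
      show n - (n - 1 - (s + 1)) = s + 2 by omega,
      show n - 1 - (s + 1) + 1 = min n (n - 1 - s) by omega]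

/-- The two words read the same `n × n` grid of crossings, one by diagonal rows, the other wire by
wire. -/
theorem braidWord_xWord (hn : 1 ≤ n) : braidWord m (xWord n) = wires m n n := by
  rw [← crossingRows_eq_wires m n le_rfl, ← crossingRows_high m n (s := 0) hn, add_zero,
    crossingRows_low m n le_rfl, xWord, braidWord_append]
  congr 2
  obtain ⟨k, rfl⟩ : ∃ k, n = k + 1 := ⟨n - 1, by omega⟩
  rw [List.range_succ, List.flatMap_append, List.flatMap_singleton]
  rfl

theorem upTo_eq : upTo n = asc 1 n := by
  simp only [upTo, asc, List.range'_eq_map_range, List.pure_def, List.bind_eq_flatMap,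
    ← List.map_eq_flatMap, List.map_map]
  refine List.map_congr_left fun k _ => ?_
  simp [add_comm]

end rows

/-! ### Writhe and permutation -/

theorem wr_letter {m k : ℕ} (h1 : 1 ≤ k) (h2 : k ≤ m) : wr (letter m k) = 1 := by
  rw [letter_natCast h1 h2, wr_sigma]

theorem wr_asc {m p r : ℕ} (hp : 1 ≤ p) (hr : p + r ≤ m + 1) :
    wr (braidWord m (asc p r)) = r := by
  induction r generalizing p with
  | zero => exact wr_one
  | succ r ih =>
    rw [asc_succ, braidWord_cons, wr_mul, ih (by omega) (by omega), wr_letter hp (by omega)]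
    push_cast; ring

theorem wr_reverse (m : ℕ) (l : List ℤ) : wr (braidWord m l.reverse) = wr (braidWord m l) := by
  induction l with
  | nil => rfl
  | cons k l ih =>
    rw [List.reverse_cons, braidWord_append, braidWord_cons, braidWord_cons, braidWord_nil,
      mul_one, wr_mul, wr_mul, ih, add_comm]

theorem wr_map_neg (m : ℕ) (l : List ℤ) :
    wr (braidWord m (l.map (- ·))) = -wr (braidWord m l) := by
  induction l with
  | nil => simp [braidWord_nil, wr_one]
  | cons k l ih =>
    rw [List.map_cons, braidWord_cons, braidWord_cons, wr_mul, wr_mul, ih, letter_neg, wr_inv]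
    ring

theorem wr_wires {m n i : ℕ} (hi : i + n ≤ m + 1) : wr (wires m n i) = i * n := by
  induction i with
  | zero => simp [wires, wr_one]
  | succ i ih =>
    rw [wires, wr_mul, ih (by omega), wr_asc (by omega) (by omega)]
    push_cast; ring

/-- The permutation of a braid, as a permutation of the natural numbers; strand positions are
counted from `1`. -/
def permNat (m : ℕ) : Braid m →* Equiv.Perm ℕ :=
  lift (fun i => adj (i + 1)) (fun i j h => adj_comm (by omega))
    (fun i j h => by simpa [← h] using adj_braid (i + 1))

theorem permNat_sigma {m : ℕ} (i : Fin m) : permNat m (sigma i) = adj (i + 1) := by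
  simp [permNat]

theorem permNat_apply {m : ℕ} (β : Braid m) (x : Fin (m + 1)) :
    permNat m β (x + 1) = perm m β x + 1 := by
  have hs : ∀ (i : Fin m) (x : Fin (m + 1)),
      adj (i + 1) (x + 1) = Equiv.swap i.castSucc i.succ x + 1 := by
    intro i x
    simp only [Equiv.swap_apply_def, Fin.ext_iff, Fin.val_castSucc, Fin.val_succ]
    split_ifs <;> simp_all
  induction β using braid_induction generalizing x with
  | one => simp
  | mul β i ih =>
    rw [map_mul, map_mul, permNat_sigma, perm_sigma, Equiv.Perm.mul_apply, hs, ih]; rfl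
  | inv β i ih =>
    rw [map_mul, map_mul, map_inv, map_inv, permNat_sigma, perm_sigma, Equiv.swap_inv,
      Equiv.swap_inv, Equiv.Perm.mul_apply, hs, ih]; rfl

theorem permNat_letter {m k : ℕ} (h1 : 1 ≤ k) (h2 : k ≤ m) : permNat m (letter m k) = adj k := by
  rw [letter_natCast h1 h2, permNat_sigma]
  simp only [Nat.sub_add_cancel h1]

theorem permNat_asc {m p r : ℕ} (hp : 1 ≤ p) (hr : p + r ≤ m + 1) :
    permNat m (braidWord m (asc p r)) = cyc p r := by
  induction r generalizing p with
  | zero => simp [asc_zero, braidWord_nil, cyc]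
  | succ r ih =>
    rw [asc_succ, braidWord_cons, map_mul, ih (by omega) (by omega),
      permNat_letter hp (by omega), cyc]

theorem permNat_letter_inv (m : ℕ) (k : ℤ) :
    (permNat m (letter m k))⁻¹ = permNat m (letter m k) := by
  by_cases h : 1 ≤ k.natAbs ∧ k.natAbs ≤ m
  · rcases Int.natAbs_eq k with e | e <;> rw [e]
    · rw [permNat_letter h.1 h.2, Equiv.swap_inv]
    · rw [letter_neg, map_inv, permNat_letter h.1 h.2, Equiv.swap_inv, Equiv.swap_inv]
  · simp [letter, h]

theorem permNat_map_neg (m : ℕ) (l : List ℤ) :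
    permNat m (braidWord m (l.map (- ·))) = permNat m (braidWord m l) := by
  induction l with
  | nil => rfl
  | cons k l ih =>
    rw [List.map_cons, braidWord_cons, braidWord_cons, map_mul, map_mul, ih, letter_neg, map_inv,
      permNat_letter_inv]

theorem permNat_reverse (m : ℕ) (l : List ℤ) :
    permNat m (braidWord m l.reverse) = (permNat m (braidWord m l))⁻¹ := by
  induction l with
  | nil => simp [braidWord_nil]
  | cons k l ih =>
    rw [List.reverse_cons, braidWord_append, braidWord_cons, braidWord_cons, braidWord_nil,
      mul_one, map_mul, map_mul, ih, mul_inv_rev, permNat_letter_inv]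

theorem permNat_wires {m n i : ℕ} (hi : i + n ≤ m + 1) :
    permNat m (wires m n i) = wiresPerm n i := by
  induction i with
  | zero => simp [wires, wiresPerm]
  | succ i ih =>
    rw [wires, map_mul, ih (by omega), permNat_asc (by omega) (by omega), wiresPerm]

/-! ### The knots -/

/-- A conjugate of the braid `β_n`. -/
def knotBraid (n : ℕ) : Braid (2 * n - 1) :=
  wires (2 * n - 1) n n * (braidWord (2 * n - 1) ((asc 1 (n - 1)).map (- ·)) *
    (braidWord (2 * n - 1) (asc 1 n).reverse * braidWord (2 * n - 1) (asc 1 n))) *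
    wires (2 * n - 1) n n * wires (2 * n - 1) n n

/-- Conjugation moves two copies of `X_n` to the end, so that the short word stands between
crossings, as the trace computation requires. -/
theorem K_eq {n : ℕ} (hn : 1 ≤ n) : K n = closure (knotBraid n) := by
  rw [K, betaWord]
  simp only [braidWord_append, braidWord_xWord _ n hn, upTo_eq]
  rw [knotBraid]
  generalize wires (2 * n - 1) n n = x
  rw [mul_assoc (x * _) x x, ← closure_mul_comm (x * x)]
  simp only [mul_assoc]

/-- The three crossings of bands count `3 n ^ 2`, the negative word `-(n - 1)`, the positive twist
`2 n`. -/
theorem wr_knotBraid {n : ℕ} (hn : 1 ≤ n) : wr (knotBraid n) = 3 * n ^ 2 + n + 1 := by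
  simp only [knotBraid, wr_mul, wr_reverse, wr_map_neg]
  rw [wr_wires (by omega), wr_asc le_rfl (by omega), wr_asc le_rfl (by omega)]
  push_cast [Nat.cast_sub hn]; ring

theorem permNat_knotBraid {n : ℕ} (hn : 1 ≤ n) :
    permNat _ (knotBraid n) = wiresPerm n n * cyc 1 (n - 1) := by
  simp only [knotBraid, map_mul, permNat_reverse, permNat_map_neg]
  rw [permNat_wires (by omega), permNat_asc le_rfl (by omega), permNat_asc le_rfl (by omega),
    inv_mul_cancel, mul_one, mul_assoc, wiresPerm_mul_self, mul_one]

theorem components_K {n : ℕ} (hn : 1 ≤ n) : components (K n) = 1 := by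
  rw [K_eq hn]
  change orbitCount (perm _ (knotBraid n)) = 1
  have q : ∀ j k : ℕ, ∀ (hj : j < 2 * n - 1 + 1) (hk : k < 2 * n - 1 + 1),
      wiresPerm n n (cyc 1 (n - 1) (j + 1)) = k + 1 →
      Quot.mk (fun x y => perm _ (knotBraid n) x = y) ⟨j, hj⟩ = Quot.mk _ ⟨k, hk⟩ := by
    intro j k hj hk h
    refine Quot.sound (Fin.ext ?_)
    have := permNat_apply (knotBraid n) ⟨j, hj⟩
    rw [permNat_knotBraid hn, Equiv.Perm.mul_apply, h] at this
    simp only at this ⊢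
    omega
  have q1 : ∀ k (hk : k < n), Quot.mk (fun x y => perm _ (knotBraid n) x = y)
      ⟨k + n, by omega⟩ = Quot.mk _ ⟨k, by omega⟩ := by
    intro k hk
    refine q _ _ _ _ ?_
    rw [cyc_of_gt (by omega), wiresPerm_right (by omega) (by omega)]
    omega
  -- The permutation sends `k` to `k + 1 + n`, and `q1` sends this to `k + 1`; positions are counted
  -- from zero here.
  have q2 : ∀ k (hk : k < n), Quot.mk (fun x y => perm _ (knotBraid n) x = y)
      ⟨k, by omega⟩ = Quot.mk _ ⟨0, by omega⟩ := by
    intro k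
    induction k with
    | zero => exact fun _ => rfl
    | succ k ih =>
      intro hk
      rw [← ih (by omega), ← q1 _ hk]
      refine (q _ _ _ _ ?_).symm
      rw [cyc_mid (by omega) (by omega), wiresPerm_left (by omega) (by omega)]
      omega
  rw [orbitCount, Nat.card_eq_one_iff_unique]
  refine ⟨⟨?_⟩, ⟨Quot.mk _ ⟨0, by omega⟩⟩⟩
  have key : ∀ a : Quot (fun x y => perm _ (knotBraid n) x = y),
      a = Quot.mk _ ⟨0, by omega⟩ := by
    rintro ⟨j, hj⟩
    rcases Nat.lt_or_ge j n with h | h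
    · exact q2 j h
    · obtain ⟨k, rfl⟩ := Nat.exists_eq_add_of_le' h
      exact (q1 k (by omega)).trans (q2 k (by omega))
  exact fun a b => (key a).trans (key b).symm

theorem coeffPoly_K {n : ℕ} (hn : 1 ≤ n) :
    coeffPoly 0 (K n) = (homfly (closure (knotBraid n))).coeff 0 := by
  rw [coeffPoly, components_K hn, K_eq hn]
  simp

/-- All powers of `z` cancel up to `(-1) ^ n * (1 + z ^ 2)`, whose constant term is taken. -/
theorem top_coeff {n : ℕ} (hn : 2 ≤ n) : ((-LaurentPolynomial.T (-1)) ^ (2 * n - 1) *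
    tau (LaurentPolynomial.T 1) (knotBraid n) : ℤ[T;T⁻¹]).coeff 0 = (-1) ^ n := by
  rw [knotBraid, tau_bands _ hn (by omega)]
  obtain ⟨k, rfl⟩ : ∃ k, n = k + 1 := ⟨n - 1, by omega⟩
  have hab : (LaurentPolynomial.T (-1) * LaurentPolynomial.T 1 : ℤ[T;T⁻¹]) = 1 := by
    rw [← LaurentPolynomial.T_add]; simp
  have e : ((-LaurentPolynomial.T (-1)) ^ (2 * (k + 1) - 1) * ((-LaurentPolynomial.T 1) ^
      (k + 1 - 1) * (LaurentPolynomial.T 1 ^ (k + 1) + LaurentPolynomial.T 1 ^ (k + 1 + 2))) :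
      ℤ[T;T⁻¹]) = LaurentPolynomial.C ((-1) ^ (k + 1)) * (LaurentPolynomial.T 0 +
        LaurentPolynomial.T 2) := by
    have h2 : (LaurentPolynomial.T 2 : ℤ[T;T⁻¹]) = LaurentPolynomial.T 1 ^ 2 := by
      rw [LaurentPolynomial.T_pow]; norm_num
    have hs : ((-1) ^ 2 : ℤ[T;T⁻¹]) = 1 := by norm_num
    have hk : ((-1) ^ (2 * k + 1) : ℤ[T;T⁻¹]) = -1 := by rw [pow_succ, pow_mul, hs, one_pow, one_mul]
    rw [show 2 * (k + 1) - 1 = 2 * k + 1 by omega, Nat.add_sub_cancel, h2,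
      LaurentPolynomial.T_zero, map_pow, map_neg, map_one,
      neg_pow (LaurentPolynomial.T (-1) : ℤ[T;T⁻¹]), neg_pow (LaurentPolynomial.T 1 : ℤ[T;T⁻¹]), hk]
    calc _ = (-1) ^ (k + 1) *
          (LaurentPolynomial.T (-1) * LaurentPolynomial.T 1) ^ (2 * k + 1) *
          (1 + LaurentPolynomial.T 1 ^ 2) := by ring
      _ = _ := by rw [hab, one_pow, mul_one]
  rw [e, coeff_C_mul, AddMonoidAlgebra.coeff_add, Finsupp.add_apply, LaurentPolynomial.T_apply,
    LaurentPolynomial.T_apply]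
  simp

end BraidLink

theorem lemma2p8 (n : ℕ) (hn : 2 ≤ n) :
    (BraidLink.coeffPoly 0 (BraidLink.K n)).degree = (((3 * n ^ 2 + 3 * n : ℕ) : ℤ) : WithBot ℤ) ∧
    (BraidLink.coeffPoly 0 (BraidLink.K n)).coeff ((3 * n ^ 2 + 3 * n : ℕ) : ℤ) = (-1) ^ n := by
  have hd : BraidLink.wr (BraidLink.knotBraid n) + ((2 * n - 1 : ℕ) : ℤ) =
      ((3 * n ^ 2 + 3 * n : ℕ) : ℤ) := by
    rw [BraidLink.wr_knotBraid (by omega)]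
    push_cast [Nat.cast_sub (show 1 ≤ 2 * n by omega)]; ring
  rw [BraidLink.coeffPoly_K (by omega)]
  have hc : ((BraidLink.homfly (BraidLink.closure (BraidLink.knotBraid n))).coeff 0).coeff
      ((3 * n ^ 2 + 3 * n : ℕ) : ℤ) = (-1) ^ n := by
    rw [← hd, BraidLink.homfly_top_coeff, BraidLink.top_coeff hn]
  refine ⟨BraidLink.degree_eq_of_coeff (fun j hj => ?_) ?_, hc⟩
  · exact BraidLink.homfly_coeff _ 0 j (by rwa [hd])
  · rw [hc]; exact pow_ne_zero _ (by norm_num)
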